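/- All locally compact spaces are Hausdorff and second countable, and carry their Borel $\sigma$-algebras. **Setting.** Let $G$ be a locally compact groupoid with unit space $G^{(0)}$, range and source maps $r,s$: all structure maps are continuous, and $r,s$ are open. A *continuous system of measures* for a map $p:Y\to Z$ is a family $(\alpha^z)_{z\in Z}$ of Radon measures, $\alpha^z$ on $p^{-1}(z)$, such that $z\mapsto\int f\,d\alpha^z$ is continuous for every $f\in C_c(Y)$ (complex-valued). Assume that $G$ has a Haar system, i.e. a continuous system of measures for $r:G\to G^{(0)}$ that is equivariant under left multiplication. Let $X$ be a locally compact left $G$-space: there are a continuous, open, surjective moment map $r_X:X\to G^{(0)}$ and a continuous action $(\gamma,x)\mapsto\gamma x$, defined for $s(\gamma)=r_X(x)$, with $r_X(\gamma x)=r(\gamma)$, $\gamma(\gamma' x)=(\gamma\gamma')x$ and $ux=x$ for units $u$. Assume that $X$ is proper, i.e. $(\gamma,x)\mapsto(\gamma x,x)$ is a proper map into $X\times X$. Let $\alpha=(\alpha^u)_{u\in G^{(0)}}$ be a continuous system of measures for $r_X$ that is $G$-equivariant, i.e. $\gamma_*\alpha^{s(\gamma)}=\alpha^{r(\gamma)}$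 for all $\gamma\in G$. Let $X*X=\{(x,y):r_X(x)=r_X(y)\}$ with the diagonal action, let $X/G$ be the orbit space of $X$ and $H=(X*X)/G$, both with the quotient topology, and write $[x]$, $[x,y]$ for classes. For $y\in X$ let $\beta_y$ be the normalized Haar measure of the (compact) isotropy group $G(y)=\{\zeta\in G:\zeta y=y\}$. **Theorem.** The following formulas give well-defined maps, with $H^{(0)}=X/G$: $$r([x,y])=[x],\quad s([x,y])=[y],\quad i([x])=[x,x],\quad [x,y]^*=[y,x],$$ and on $H^{(2)}=\{(h,k)\in H\times H: s(h)=r(k)\}$, all of whose elements have the form $([x,y],[y,z])$, a map $m$ into the Borel probability measures on $H$, $$\int f\,dm([x,y],[y,z])=\int_{G(y)} f([\zeta x,z])\,d\beta_y(\zeta).$$ Likewise, letting $\lambda^{[x]}$ be the image of $\alpha^{r_X(x)}$ under $r_X^{-1}(r_X(x))\to r^{-1}([x])$, $y\mapsto[x,y]$, gives a well-defined family of measures $\lambda=(\lambda^{[x]})_{[x]\in X/G}$. With these data $H$ is a *locally compact hypergroupoid*, which means: $H$ and $H^{(0)}$ are locally compact; $r,s:H\to H^{(0)}$ are continuous, open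 and surjective; $i$ is a continuous injection with $r\circ i=s\circ i=\mathrm{id}$; $h\mapsto h^*$ is a continuous involution with $r(h^*)=s(h)$; and, writing $f(h*k)=\int f\,dm(h,k)$, 1. for $(h,k)\in H^{(2)}$ the support of $m(h,k)$ is a compact subset of $\{w: r(w)=r(h),\ s(w)=s(k)\}$; 2. if $s(h)=r(k)$ and $s(k)=r(l)$, then $\int m(h,\cdot)\,dm(k,l)=\int m(\cdot,l)\,dm(h,k)$, i.e. $\int f(h*w)\,dm(k,l)(w)=\int f(w*l)\,dm(h,k)(w)$ for all $f\in C_c(H)$; 3. $m(i(r(h)),h)=m(h,i(s(h)))=\delta_h$ for all $h\in H$; 4. for $(h,k)\in H^{(2)}$ the image of $m(h,k)$ under the involution is $m(k^*,h^*)$; 5. for $(h,k)\in H^{(2)}$ one has $h=k^*$ if and only if the support of $m(h,k)$ meets $i(H^{(0)})$; 6. for all $f\in C_c(H)$ and $\epsilon>0$ there is a neighborhood $U$ of $i(H^{(0)})$ in $H$ such that $|f(h)-f(k^*)|\le\epsilon$ for all $(h,k)\in H^{(2)}$ for which the support of $m(h,k)$ meets $U$; 7. for all $h\in H$ and $f\in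 C_c(r^{-1}(s(h)))$, the function $k\mapsto f(h^**k)$ on $r^{-1}(r(h))$ is continuous with compact support. Moreover $\lambda$ is a *Haar system* on $H$, which means: $\lambda$ is a continuous system of measures for $r:H\to H^{(0)}$, and for all $f,g\in C_c(H)$ $$\int f(h*k)\,g(k)\,d\lambda^{s(h)}(k)=\int f(k)\,g(h^**k)\,d\lambda^{r(h)}(k)\qquad(h\in H),$$ and the function $h\mapsto\int f(h*k)\,g(k)\,d\lambda^{s(h)}(k)$ on $H$ is continuous with compact support. -/

import Mathlib

open MeasureTheory Topology
open scoped CompactlySupported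

/-! ### Topological groupoids -/

/-- A topological groupoid with space of arrows `G` and unit space `G0`: a product `mul γ γ' h`
defined exactly for the composable pairs (`h : s γ = r γ'`), with units and inverses, all structure
maps being continuous and the range and source maps being open. The map `unit` is the inclusion of
the unit space; being a continuous section of `r`, it is a topological embedding. -/
structure TopGroupoid (G G0 : Type*) [TopologicalSpace G] [TopologicalSpace G0] where
  r : G → G0
  s : G → G0
  unit : G0 → G
  inv : G → G
  mul : (γ γ' : G) → s γ = r γ' → G
  r_unit : ∀ u, r (unit u) = u
  s_unit : ∀ u, s (unit u) = u
  r_inv : ∀ γ, r (inv γ) = s γ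
  s_inv : ∀ γ, s (inv γ) = r γ
  r_mul : ∀ γ γ' h, r (mul γ γ' h) = r γ
  s_mul : ∀ γ γ' h, s (mul γ γ' h) = s γ'
  mul_assoc : ∀ (γ₁ γ₂ γ₃ : G) (h₁₂ : s γ₁ = r γ₂) (h₂₃ : s γ₂ = r γ₃),
    mul (mul γ₁ γ₂ h₁₂) γ₃ ((s_mul γ₁ γ₂ h₁₂).trans h₂₃) =
      mul γ₁ (mul γ₂ γ₃ h₂₃) (h₁₂.trans (r_mul γ₂ γ₃ h₂₃).symm)
  unit_mul : ∀ γ, mul (unit (r γ)) γ (s_unit _) = γ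
  mul_unit : ∀ γ, mul γ (unit (s γ)) (r_unit _).symm = γ
  inv_mul : ∀ γ, mul (inv γ) γ (s_inv γ) = unit (s γ)
  mul_inv : ∀ γ, mul γ (inv γ) (r_inv γ).symm = unit (r γ)
  continuous_r : Continuous r
  continuous_s : Continuous s
  isOpenMap_r : IsOpenMap r
  isOpenMap_s : IsOpenMap s
  continuous_unit : Continuous unit
  continuous_inv : Continuous inv
  continuous_mul : Continuous fun p : {p : G × G // s p.1 = r p.2} => mul p.1.1 p.1.2 p.2

/-! ### Actions of groupoids -/

/-- A left action of the groupoid `𝓖` on the set `X`, fibred over the unit space by the surjective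
moment map `r`; `γ x` is defined when `s γ = r x`. Only the algebra is recorded here. -/
structure GroupoidAction {G G0 : Type*} [TopologicalSpace G] [TopologicalSpace G0]
    (𝓖 : TopGroupoid G G0) (X : Type*) where
  r : X → G0
  r_surjective : Function.Surjective r
  smul : (γ : G) → (x : X) → 𝓖.s γ = r x → X
  r_smul : ∀ γ x h, r (smul γ x h) = 𝓖.r γ
  unit_smul : ∀ x, smul (𝓖.unit (r x)) x (𝓖.s_unit _) = x
  mul_smul : ∀ (γ γ' : G) (x : X) (h : 𝓖.s γ = 𝓖.r γ') (h' : 𝓖.s γ' = r x),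
    smul (𝓖.mul γ γ' h) x ((𝓖.s_mul γ γ' h).trans h') =
      smul γ (smul γ' x h') (h.trans (r_smul γ' x h').symm)

/-- The action of a groupoid on its space of arrows by left multiplication. -/
def TopGroupoid.leftMul {G G0 : Type*} [TopologicalSpace G] [TopologicalSpace G0]
    (𝓖 : TopGroupoid G G0) : GroupoidAction 𝓖 G where
  r := 𝓖.r
  r_surjective := fun u => ⟨𝓖.unit u, 𝓖.r_unit u⟩
  smul := 𝓖.mul
  r_smul := 𝓖.r_mul
  unit_smul := 𝓖.unit_mul
  mul_smul := fun γ γ' x h h' => 𝓖.mul_assoc γ γ' x h h'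

namespace GroupoidAction

variable {G G0 X : Type*} [TopologicalSpace G] [TopologicalSpace G0] {𝓖 : TopGroupoid G G0}

/-- The topological requirements on a `G`-space: the moment map is continuous and open, and the
action map is continuous on the fibred product `G * X`. -/
structure IsTopological [TopologicalSpace X] (A : GroupoidAction 𝓖 X) : Prop where
  continuous_r : Continuous A.r
  isOpenMap_r : IsOpenMap A.r
  continuous_smul :
    Continuous fun p : {p : G × X // 𝓖.s p.1 = A.r p.2} => A.smul p.1.1 p.1.2 p.2

/-- The action is proper: the map `(γ, x) ↦ (γ x, x)` from `G * X` to `X × X` is proper. -/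
def IsProper [TopologicalSpace X] (A : GroupoidAction 𝓖 X) : Prop :=
  IsProperMap fun p : {p : G × X // 𝓖.s p.1 = A.r p.2} => (A.smul p.1.1 p.1.2 p.2, p.1.2)

/-- The orbit equivalence relation: `x ∼ y` if and only if `x = γ y` for some `γ`. -/
def orbitSetoid (A : GroupoidAction 𝓖 X) : Setoid X where
  r x y := ∃ (γ : G) (h : 𝓖.s γ = A.r y), x = A.smul γ y h
  iseqv :=
    { refl := fun x => ⟨𝓖.unit (A.r x), 𝓖.s_unit _, (A.unit_smul x).symm⟩
      symm := by
        rintro x y ⟨γ, h, rfl⟩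
        refine ⟨𝓖.inv γ, (𝓖.s_inv γ).trans (A.r_smul γ y h).symm, ?_⟩
        rw [← A.mul_smul _ _ _ (𝓖.s_inv γ) h]
        simp only [𝓖.inv_mul, h, A.unit_smul]
      trans := by
        rintro x y z ⟨γ, h, rfl⟩ ⟨γ', h', rfl⟩
        have hc : 𝓖.s γ = 𝓖.r γ' := h.trans (A.r_smul γ' z h')
        exact ⟨𝓖.mul γ γ' hc, (𝓖.s_mul γ γ' hc).trans h', (A.mul_smul γ γ' z hc h').symm⟩ }

/-- The orbit space, with the quotient topology and its Borel structure (instances below). -/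
def OrbitSpace (A : GroupoidAction 𝓖 X) : Type _ := Quotient A.orbitSetoid

/-- The class of a point in the orbit space. -/
def toOrbit (A : GroupoidAction 𝓖 X) (x : X) : A.OrbitSpace := Quotient.mk A.orbitSetoid x

instance [TopologicalSpace X] (A : GroupoidAction 𝓖 X) : TopologicalSpace A.OrbitSpace :=
  inferInstanceAs (TopologicalSpace (Quotient A.orbitSetoid))

instance [TopologicalSpace X] (A : GroupoidAction 𝓖 X) : MeasurableSpace A.OrbitSpace :=
  borel _

instance [TopologicalSpace X] (A : GroupoidAction 𝓖 X) : BorelSpace A.OrbitSpace := ⟨rfl⟩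

/-- The fibred product `X * X` over the unit space (with the subspace topology of `X × X`). -/
abbrev FibreSquare (A : GroupoidAction 𝓖 X) : Type _ := {p : X × X // A.r p.1 = A.r p.2}

/-- The diagonal action `γ (x, y) = (γ x, γ y)` on `X * X`. -/
def diag (A : GroupoidAction 𝓖 X) : GroupoidAction 𝓖 A.FibreSquare where
  r p := A.r p.1.1
  r_surjective := fun u => by
    obtain ⟨x, hx⟩ := A.r_surjective u
    exact ⟨⟨(x, x), rfl⟩, hx⟩
  smul γ p h := ⟨(A.smul γ p.1.1 h, A.smul γ p.1.2 (h.trans p.2)),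
    (A.r_smul _ _ _).trans (A.r_smul _ _ _).symm⟩
  r_smul := fun γ p h => A.r_smul γ p.1.1 h
  unit_smul := by
    rintro ⟨⟨x, y⟩, h⟩
    apply Subtype.ext
    apply Prod.ext
    · exact A.unit_smul x
    · change A.r x = A.r y at h
      simp only [h]
      exact A.unit_smul y
  mul_smul := by
    rintro γ γ' ⟨⟨x, y⟩, hxy⟩ h h'
    apply Subtype.ext
    apply Prod.ext
    · exact A.mul_smul γ γ' x h h'
    · exact A.mul_smul γ γ' y h (h'.trans hxy)

/-- The space `H = (X * X) / G`. -/
abbrev PairSpace (A : GroupoidAction 𝓖 X) : Type _ := A.diag.OrbitSpace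

/-- The class `[x, y]` in `(X * X) / G`. -/
def pair (A : GroupoidAction 𝓖 X) (x y : X) (h : A.r x = A.r y) : A.PairSpace :=
  A.diag.toOrbit ⟨(x, y), h⟩

/-! ### Isotropy groups -/

/-- The isotropy group `G(y) = {ζ ∈ G : ζ y = y}`, with the topology and the Borel structure
induced by `G` (instances below). -/
def Isotropy (A : GroupoidAction 𝓖 X) (y : X) : Type _ :=
  {ζ : G // ∃ h : 𝓖.s ζ = A.r y, A.smul ζ y h = y}

namespace Isotropy

variable {A : GroupoidAction 𝓖 X} {y : X}

/-- The underlying arrow. -/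
def val (ζ : A.Isotropy y) : G := Subtype.val ζ

theorem s_val (ζ : A.Isotropy y) : 𝓖.s ζ.val = A.r y := (Subtype.property ζ).1

theorem smul_val (ζ : A.Isotropy y) : A.smul ζ.val y ζ.s_val = y := (Subtype.property ζ).2

theorem r_val (ζ : A.Isotropy y) : 𝓖.r ζ.val = A.r y := by
  have h := A.r_smul ζ.val y ζ.s_val
  rw [smul_val] at h
  exact h.symm

theorem ext {ζ η : A.Isotropy y} (h : ζ.val = η.val) : ζ = η := Subtype.ext h

instance : TopologicalSpace (A.Isotropy y) :=
  inferInstanceAs (TopologicalSpace {ζ : G // ∃ h : 𝓖.s ζ = A.r y, A.smul ζ y h = y})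

instance [MeasurableSpace G] : MeasurableSpace (A.Isotropy y) :=
  inferInstanceAs (MeasurableSpace {ζ : G // ∃ h : 𝓖.s ζ = A.r y, A.smul ζ y h = y})

instance [MeasurableSpace G] [BorelSpace G] : BorelSpace (A.Isotropy y) :=
  inferInstanceAs (BorelSpace {ζ : G // ∃ h : 𝓖.s ζ = A.r y, A.smul ζ y h = y})

instance : Mul (A.Isotropy y) :=
  ⟨fun ζ η => ⟨𝓖.mul ζ.val η.val (ζ.s_val.trans η.r_val.symm), (𝓖.s_mul _ _ _).trans η.s_val, by
    rw [A.mul_smul _ _ _ _ η.s_val]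
    simp only [smul_val]⟩⟩

instance : One (A.Isotropy y) := ⟨⟨𝓖.unit (A.r y), 𝓖.s_unit _, A.unit_smul y⟩⟩

instance : Inv (A.Isotropy y) :=
  ⟨fun ζ => ⟨𝓖.inv ζ.val, (𝓖.s_inv _).trans ζ.r_val, by
    have h := A.mul_smul (𝓖.inv ζ.val) ζ.val y (𝓖.s_inv _) ζ.s_val
    simp only [𝓖.inv_mul, smul_val, ζ.s_val, A.unit_smul] at h
    exact h.symm⟩⟩

theorem mul_val (ζ η : A.Isotropy y) :
    (ζ * η).val = 𝓖.mul ζ.val η.val (ζ.s_val.trans η.r_val.symm) := rfl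

theorem one_val : (1 : A.Isotropy y).val = 𝓖.unit (A.r y) := rfl

theorem inv_val (ζ : A.Isotropy y) : (ζ⁻¹).val = 𝓖.inv ζ.val := rfl

instance : Group (A.Isotropy y) where
  mul_assoc ζ η θ := ext (𝓖.mul_assoc _ _ _ _ _)
  one_mul ζ := ext (by
    have h := 𝓖.unit_mul ζ.val
    simp only [r_val] at h
    exact h)
  mul_one ζ := ext (by
    have h := 𝓖.mul_unit ζ.val
    simp only [s_val] at h
    exact h)
  inv_mul_cancel ζ := ext (by
    rw [mul_val, one_val]
    have h := 𝓖.inv_mul ζ.val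
    rw [s_val] at h
    exact h)

theorem continuous_val : Continuous (val : A.Isotropy y → G) := continuous_subtype_val

instance : IsTopologicalGroup (A.Isotropy y) where
  continuous_mul := by
    have h1 : Continuous fun p : A.Isotropy y × A.Isotropy y =>
        (⟨(p.1.val, p.2.val), p.1.s_val.trans p.2.r_val.symm⟩ :
          {p : G × G // 𝓖.s p.1 = 𝓖.r p.2}) :=
      Continuous.subtype_mk ((continuous_val.comp continuous_fst).prodMk
        (continuous_val.comp continuous_snd)) _
    exact Continuous.subtype_mk (𝓖.continuous_mul.comp h1) _
  continuous_inv := Continuous.subtype_mk (𝓖.continuous_inv.comp continuous_val) _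

/-- The isotropy groups of a proper action are compact. -/
theorem compactSpace [TopologicalSpace X] (hA : A.IsProper) : CompactSpace (A.Isotropy y) := by
  have h1 := hA.isCompact_preimage (isCompact_singleton (x := (y, y)))
  have h2 := h1.image (continuous_fst.comp continuous_subtype_val)
  suffices h : IsCompact {ζ : G | ∃ h : 𝓖.s ζ = A.r y, A.smul ζ y h = y} from
    isCompact_iff_compactSpace.mp h
  convert h2 using 1
  ext ζ
  constructor
  · rintro ⟨h, hy⟩
    exact ⟨⟨(ζ, y), h⟩, Prod.ext hy rfl, rfl⟩
  · rintro ⟨⟨⟨ζ', x⟩, h⟩, hx, rfl⟩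
    obtain ⟨hx1, hx2⟩ := Prod.mk.inj hx
    change x = y at hx2
    subst hx2
    exact ⟨h, hx1⟩

end Isotropy

/-- The normalized Haar measure `β_y` of the compact group `G(y)`. -/
noncomputable def isotropyHaar [TopologicalSpace X] [MeasurableSpace G] [BorelSpace G]
    (A : GroupoidAction 𝓖 X) (hA : A.IsProper) (y : X) : Measure (A.Isotropy y) :=
  haveI := Isotropy.compactSpace (y := y) hA
  Measure.haarMeasure ⊤

end GroupoidAction

/-! ### Systems of measures -/

/-- A continuous system of measures for the map `p : Y → Z`: for each `z` a Radon measure on the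
fibre over `z`, such that integrals of continuous functions with compact support on `Y` depend
continuously on `z`. -/
structure IsContinuousSystem {Y Z : Type*} [TopologicalSpace Y] [TopologicalSpace Z]
    [MeasurableSpace Y] [BorelSpace Y] (p : Y → Z) (α : ∀ z, Measure {y // p y = z}) : Prop where
  regular : ∀ z, (α z).Regular
  continuous_integral : ∀ f : C_c(Y, ℂ), Continuous fun z => ∫ y, f y.1 ∂(α z)

/-- Equivariance of a system of measures for the moment map: `γ` carries the measure on the fibre
over `s γ` to the measure on the fibre over `r γ`. -/
def GroupoidAction.IsEquivariant {G G0 X : Type*} [TopologicalSpace G] [TopologicalSpace G0]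
    {𝓖 : TopGroupoid G G0} [MeasurableSpace X] (A : GroupoidAction 𝓖 X)
    (α : ∀ u, Measure {x // A.r x = u}) : Prop :=
  ∀ γ : G, (α (𝓖.s γ)).map
    (fun x => (⟨A.smul γ x.1 x.2.symm, A.r_smul γ x.1 x.2.symm⟩ : {x // A.r x = 𝓖.r γ})) =
      α (𝓖.r γ)

/-- A (left) Haar system on a groupoid: a continuous system of measures for the range map which is
equivariant under left multiplication. -/
def TopGroupoid.IsHaarSystem {G G0 : Type*} [TopologicalSpace G] [TopologicalSpace G0]
    [MeasurableSpace G] [BorelSpace G] (𝓖 : TopGroupoid G G0)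
    (lam : ∀ u, Measure {γ // 𝓖.r γ = u}) : Prop :=
  IsContinuousSystem 𝓖.r lam ∧ 𝓖.leftMul.IsEquivariant lam

/-! ### Hypergroupoids -/

/-- The data of a hypergroupoid with underlying space `H` and unit space `H0`; the product `m` is
defined on the composable pairs and takes values in the (Borel) probability measures on `H`. -/
structure HypergroupoidData (H H0 : Type*) [MeasurableSpace H] where
  r : H → H0
  s : H → H0
  unit : H0 → H
  star : H → H
  m : (x y : H) → s x = r y → ProbabilityMeasure H

namespace HypergroupoidData

variable {H H0 : Type*} [MeasurableSpace H]

open Classical in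
/-- The measure `m (x, y)`, extended by `0` to the pairs which are not composable. -/
noncomputable def prod (𝓗 : HypergroupoidData H H0) (x y : H) : Measure H :=
  if h : 𝓗.s x = 𝓗.r y then (𝓗.m x y h : Measure H) else 0

/-- `f (x * y) = ∫ f dm(x, y)` (and `0` when `x`, `y` are not composable). -/
noncomputable def conv (𝓗 : HypergroupoidData H H0) (f : H → ℂ) (x y : H) : ℂ :=
  ∫ w, f w ∂(𝓗.prod x y)

/-- The left translation operator: for a function `f` on the fibre `H^{s(x)}`, the function
`y ↦ f (x^* * y)` on the fibre `H^{r(x)}`. The measure `m (x^*, y)`, which lives on the fibre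
`H^{s(x)}`, is restricted to this fibre. -/
noncomputable def leftTranslate (𝓗 : HypergroupoidData H H0) (x : H)
    (f : {w // 𝓗.r w = 𝓗.s x} → ℂ) (y : {y // 𝓗.r y = 𝓗.r x}) : ℂ :=
  ∫ w, f w ∂((𝓗.prod (𝓗.star x) y.1).comap Subtype.val)

variable [TopologicalSpace H] [TopologicalSpace H0]

/-- The axioms of a locally compact hypergroupoid (locally compact spaces being Hausdorff and second
countable). -/
structure IsLocallyCompactHypergroupoid (𝓗 : HypergroupoidData H H0) : Prop where
  locallyCompactSpace : LocallyCompactSpace H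
  t2Space : T2Space H
  secondCountableTopology : SecondCountableTopology H
  locallyCompactSpace_unit : LocallyCompactSpace H0
  t2Space_unit : T2Space H0
  secondCountableTopology_unit : SecondCountableTopology H0
  continuous_r : Continuous 𝓗.r
  isOpenMap_r : IsOpenMap 𝓗.r
  surjective_r : Function.Surjective 𝓗.r
  continuous_s : Continuous 𝓗.s
  isOpenMap_s : IsOpenMap 𝓗.s
  surjective_s : Function.Surjective 𝓗.s
  continuous_unit : Continuous 𝓗.unit
  injective_unit : Function.Injective 𝓗.unit
  r_unit : ∀ u, 𝓗.r (𝓗.unit u) = u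
  s_unit : ∀ u, 𝓗.s (𝓗.unit u) = u
  continuous_star : Continuous 𝓗.star
  star_star : ∀ x, 𝓗.star (𝓗.star x) = x
  r_star : ∀ x, 𝓗.r (𝓗.star x) = 𝓗.s x
  isCompact_support : ∀ x y, 𝓗.s x = 𝓗.r y → IsCompact (𝓗.prod x y).support
  support_subset : ∀ x y, 𝓗.s x = 𝓗.r y →
    (𝓗.prod x y).support ⊆ {w | 𝓗.r w = 𝓗.r x ∧ 𝓗.s w = 𝓗.s y}
  /-- Associativity: `∫ m(x, ·) dm(y, z) = ∫ m(·, z) dm(x, y)` as Radon measures. -/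
  assoc : ∀ x y z, 𝓗.s x = 𝓗.r y → 𝓗.s y = 𝓗.r z → ∀ f : C_c(H, ℂ),
    ∫ w, 𝓗.conv f x w ∂(𝓗.prod y z) = ∫ w, 𝓗.conv f w z ∂(𝓗.prod x y)
  unit_prod : ∀ x, 𝓗.prod (𝓗.unit (𝓗.r x)) x = Measure.dirac x
  prod_unit : ∀ x, 𝓗.prod x (𝓗.unit (𝓗.s x)) = Measure.dirac x
  map_star : ∀ x y, 𝓗.s x = 𝓗.r y →
    (𝓗.prod x y).map 𝓗.star = 𝓗.prod (𝓗.star y) (𝓗.star x)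
  eq_star_iff : ∀ x y, 𝓗.s x = 𝓗.r y →
    (x = 𝓗.star y ↔ ((𝓗.prod x y).support ∩ Set.range 𝓗.unit).Nonempty)
  exists_nhds : ∀ (f : C_c(H, ℂ)) (ε : ℝ), 0 < ε → ∃ U ∈ 𝓝ˢ (Set.range 𝓗.unit),
    ∀ x y, 𝓗.s x = 𝓗.r y → ((𝓗.prod x y).support ∩ U).Nonempty →
      ‖f x - f (𝓗.star y)‖ ≤ ε
  leftTranslate_mem : ∀ (x : H) (f : C_c({w // 𝓗.r w = 𝓗.s x}, ℂ)),
    Continuous (𝓗.leftTranslate x f) ∧ HasCompactSupport (𝓗.leftTranslate x f)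

/-- A Haar system on a locally compact hypergroupoid. -/
structure IsHaarSystem [BorelSpace H] (𝓗 : HypergroupoidData H H0)
    (lam : ∀ u, Measure {w // 𝓗.r w = u}) : Prop where
  isContinuousSystem : IsContinuousSystem 𝓗.r lam
  adjoint : ∀ (f g : C_c(H, ℂ)) (x : H),
    ∫ y, 𝓗.conv f x y.1 * g y.1 ∂(lam (𝓗.s x)) =
      ∫ y, f y.1 * 𝓗.conv g (𝓗.star x) y.1 ∂(lam (𝓗.r x))
  continuous_convolution : ∀ f g : C_c(H, ℂ),
    Continuous fun x => ∫ y, 𝓗.conv f x y.1 * g y.1 ∂(lam (𝓗.s x))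
  hasCompactSupport_convolution : ∀ f g : C_c(H, ℂ),
    HasCompactSupport fun x => ∫ y, 𝓗.conv f x y.1 * g y.1 ∂(lam (𝓗.s x))

end HypergroupoidData

/-! ### The structure carried by `(X * X) / G` -/

/-- The explicit formulas for the structure on `H = (X * X) / G`, with unit space `X / G`. As every
element of `H` is of the form `[x, y]` and every composable pair of the form `([x, y], [y, z])`,
they determine the hypergroupoid data and the system of measures `lam`. -/
structure GroupoidAction.IsSpatialStructure {G G0 X : Type*} [TopologicalSpace G]
    [TopologicalSpace G0] [TopologicalSpace X] [MeasurableSpace G] [BorelSpace G]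
    [MeasurableSpace X] {𝓖 : TopGroupoid G G0} (A : GroupoidAction 𝓖 X) (hA : A.IsProper)
    (α : ∀ u, Measure {x // A.r x = u})
    (𝓗 : HypergroupoidData A.PairSpace A.OrbitSpace) (lam : ∀ u, Measure {w // 𝓗.r w = u}) :
    Prop where
  r_pair : ∀ x y h, 𝓗.r (A.pair x y h) = A.toOrbit x
  s_pair : ∀ x y h, 𝓗.s (A.pair x y h) = A.toOrbit y
  unit_toOrbit : ∀ x, 𝓗.unit (A.toOrbit x) = A.pair x x rfl
  star_pair : ∀ x y h, 𝓗.star (A.pair x y h) = A.pair y x h.symm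
  /-- `m([x, y], [y, z])` is the image of `β_y` under `ζ ↦ [ζ x, z]`. -/
  m_pair : ∀ (x y z : X) (hxy : A.r x = A.r y) (hyz : A.r y = A.r z),
    (𝓗.m (A.pair x y hxy) (A.pair y z hyz) ((s_pair x y hxy).trans (r_pair y z hyz).symm) :
      Measure A.PairSpace) =
      (A.isotropyHaar hA y).map fun ζ =>
        A.pair (A.smul ζ.val x (ζ.s_val.trans hxy.symm)) z
          ((A.r_smul _ _ _).trans (ζ.r_val.trans hyz))
  /-- `lam^{[x]}` is the image of `α^{r(x)}` under `y ↦ [x, y]`. -/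
  lam_toOrbit : ∀ x : X, lam (A.toOrbit x) =
    (α (A.r x)).map fun y => ⟨A.pair x y.1 y.2.symm, r_pair x y.1 y.2.symm⟩

/-! Two facts carry everything. First, orbit maps are open quotient maps and properness passes to
the diagonal action. Hence `X/G` and `H` inherit their topology from `X`, compact sets lift, and if
`x` and `[x, y]` each stay in a compact set, so does `y` (`exists_isCompact_of_pair_mem`). Together
with a Tietze extension of functions of `[x, y]` to `X × X`, this gives all uniform estimates,
compact supports and continuous integrals.

Second, the product is an average over a compact group. A representative of a composable pair is
unique up to a common arrow and an element of `G(y)` acting on `z`. Conjugation carries `β_y` to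
`β_{γy}` by uniqueness of normalized Haar measure, and left invariance absorbs the element of
`G(y)`, so `m` is well defined (`prodMeasure_congr`). Inversion invariance of `β_y` gives the
involution axiom. Since `[ζx, z] = [x, ζ⁻¹z]`, the averages over `G(y)` and `G(z)` act on different
entries, and associativity is Fubini (`conv_assoc`). Full support of `β_y` identifies the support of
`m` with the range of `ζ ↦ [ζx, z]`, which decides the axioms about supports.

For the Haar system, equivariance of `α` makes the isotropy average disappear after integration
(`integral_average_mul`). The convolution integral at `[a, b]` becomes `∫ f[a, z] g[b, z] dα(z)`
(`integral_conv_mul`). This is symmetric under exchanging `(a, f)` and `(b, g)`, which is the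
adjoint identity; its continuity and compact support follow from the first fact. -/

/-! ### Open quotient maps, fibre products and compactness -/

/-- The base change of an open map along a continuous map is open. -/
theorem isOpenMap_fibreProduct_snd {A B C : Type*} [TopologicalSpace A] [TopologicalSpace B]
    [TopologicalSpace C] {f : A → C} {g : B → C} (hf : IsOpenMap f) (hg : Continuous g) :
    IsOpenMap fun p : {p : A × B // f p.1 = g p.2} => p.1.2 := by
  intro U hU
  obtain ⟨V, hV, rfl⟩ := isOpen_induced_iff.mp hU
  rw [isOpen_iff_mem_nhds]
  rintro _ ⟨⟨⟨a, b⟩, hab⟩, hp, rfl⟩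
  obtain ⟨V₁, V₂, hV₁, hV₂, ha, hb, hVV⟩ := isOpen_prod_iff.mp hV a b hp
  have h1 : V₂ ∩ g ⁻¹' (f '' V₁) ∈ 𝓝 b :=
    (hV₂.inter ((hf V₁ hV₁).preimage hg)).mem_nhds ⟨hb, a, ha, hab⟩
  refine Filter.mem_of_superset h1 ?_
  rintro b' ⟨hb', a', ha', h'⟩
  exact ⟨⟨(a', b'), h'⟩, hVV ⟨ha', hb'⟩, rfl⟩

/-- A compact set in the image of an open quotient map of a locally compact space lifts to a
compact set. -/
theorem IsOpenQuotientMap.exists_isCompact_subset_image {Y Z : Type*} [TopologicalSpace Y]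
    [TopologicalSpace Z] [LocallyCompactSpace Y] {q : Y → Z} (hq : IsOpenQuotientMap q)
    {K : Set Z} (hK : IsCompact K) : ∃ L : Set Y, IsCompact L ∧ K ⊆ q '' L := by
  refine hK.induction_on (p := fun K => ∃ L : Set Y, IsCompact L ∧ K ⊆ q '' L)
    ⟨∅, isCompact_empty, Set.empty_subset _⟩ ?_ ?_ ?_
  · rintro s t hst ⟨L, hL, h⟩
    exact ⟨L, hL, hst.trans h⟩
  · rintro s t ⟨L, hL, h⟩ ⟨L', hL', h'⟩
    exact ⟨L ∪ L', hL.union hL', by rw [Set.image_union]; exact Set.union_subset_union h h'⟩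
  · intro z _
    obtain ⟨y, rfl⟩ := hq.surjective z
    obtain ⟨L, hL, hy⟩ := exists_compact_mem_nhds y
    exact ⟨q '' L, mem_nhdsWithin_of_mem_nhds (hq.isOpenMap.image_mem_nhds hy), L, hL, subset_rfl⟩

namespace GroupoidAction

variable {G G0 X : Type*} [TopologicalSpace G] [TopologicalSpace G0] {𝓖 : TopGroupoid G G0}
  {A : GroupoidAction 𝓖 X}

/-! ### Orbits and classes of pairs -/

theorem toOrbit_eq_iff {x y : X} :
    A.toOrbit x = A.toOrbit y ↔ ∃ (γ : G) (h : 𝓖.s γ = A.r y), x = A.smul γ y h :=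
  Quotient.eq (r := A.orbitSetoid)

theorem toOrbit_smul (γ : G) (x : X) (h : 𝓖.s γ = A.r x) :
    A.toOrbit (A.smul γ x h) = A.toOrbit x :=
  toOrbit_eq_iff.mpr ⟨γ, h, rfl⟩

theorem toOrbit_surjective (A : GroupoidAction 𝓖 X) : Function.Surjective A.toOrbit :=
  Quotient.mk_surjective

theorem pair_eq_pair_iff {x y x' y' : X} (h : A.r x = A.r y) (h' : A.r x' = A.r y') :
    A.pair x y h = A.pair x' y' h' ↔ ∃ (γ : G) (hx : 𝓖.s γ = A.r x') (hy : 𝓖.s γ = A.r y'),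
      x = A.smul γ x' hx ∧ y = A.smul γ y' hy := by
  refine (toOrbit_eq_iff (A := A.diag)).trans ?_
  constructor
  · rintro ⟨γ, hγ, he⟩
    obtain ⟨h1, h2⟩ := Prod.mk.inj (congrArg Subtype.val he)
    exact ⟨γ, hγ, hγ.trans h', h1, h2⟩
  · rintro ⟨γ, hx, hy, rfl, rfl⟩
    exact ⟨γ, hx, rfl⟩

theorem pair_smul_smul {x y : X} (h : A.r x = A.r y) (γ : G) (hx : 𝓖.s γ = A.r x)
    (hy : 𝓖.s γ = A.r y) (h' : A.r (A.smul γ x hx) = A.r (A.smul γ y hy)) :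
    A.pair (A.smul γ x hx) (A.smul γ y hy) h' = A.pair x y h :=
  (pair_eq_pair_iff _ _).mpr ⟨γ, hx, hy, rfl, rfl⟩

theorem exists_pair (w : A.PairSpace) : ∃ x y h, w = A.pair x y h := by
  obtain ⟨⟨⟨x, y⟩, h⟩, rfl⟩ := A.diag.toOrbit_surjective w
  exact ⟨x, y, h, rfl⟩

variable [TopologicalSpace X]

/-! ### Orbit spaces of topological and proper actions -/

theorem continuous_toOrbit (A : GroupoidAction 𝓖 X) : Continuous A.toOrbit :=
  continuous_quotient_mk'

/-- The saturation of an open set `U` is the projection to `X` of the preimage of `U` under the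
action map. That projection is a base change of the open map `s`, hence open. -/
theorem IsTopological.isOpenQuotientMap_toOrbit (hA : A.IsTopological) :
    IsOpenQuotientMap A.toOrbit := by
  refine ⟨A.toOrbit_surjective, A.continuous_toOrbit, fun U hU => ?_⟩
  refine isOpen_coinduced.mpr ?_
  have h1 := isOpenMap_fibreProduct_snd 𝓖.isOpenMap_s hA.continuous_r _
    (hU.preimage hA.continuous_smul)
  convert h1 using 1
  ext y
  constructor
  · rintro ⟨x, hx, hxy⟩
    obtain ⟨γ, h, rfl⟩ := toOrbit_eq_iff.mp hxy
    exact ⟨⟨(γ, y), h⟩, hx, rfl⟩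
  · rintro ⟨⟨⟨γ, y⟩, h⟩, hx, rfl⟩
    exact ⟨A.smul γ y h, hx, toOrbit_smul γ y h⟩

/-- The orbit relation is the range of the proper map `(γ, x) ↦ (γx, x)`, hence closed; for an open
quotient map this is equivalent to a Hausdorff quotient. -/
theorem IsTopological.t2Space_orbitSpace (hA : A.IsTopological) (hp : A.IsProper) :
    T2Space A.OrbitSpace := by
  rw [t2Space_iff_of_isOpenQuotientMap hA.isOpenQuotientMap_toOrbit]
  convert hp.isClosedMap.isClosed_range using 1
  ext ⟨x, y⟩
  constructor
  · intro h
    obtain ⟨γ, h', hx : x = _⟩ := toOrbit_eq_iff.mp h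
    exact ⟨⟨(γ, y), h'⟩, Prod.ext hx.symm rfl⟩
  · rintro ⟨⟨⟨γ, y⟩, h⟩, hx⟩
    obtain ⟨rfl, rfl⟩ := Prod.mk.inj hx
    exact toOrbit_smul γ y h

theorem IsTopological.locallyCompactSpace_orbitSpace [LocallyCompactSpace X]
    (hA : A.IsTopological) : LocallyCompactSpace A.OrbitSpace :=
  hA.isOpenQuotientMap_toOrbit.locallyCompactSpace

theorem IsTopological.secondCountableTopology_orbitSpace [SecondCountableTopology X]
    (hA : A.IsTopological) : SecondCountableTopology A.OrbitSpace :=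
  hA.isOpenQuotientMap_toOrbit.isQuotientMap.secondCountableTopology
    hA.isOpenQuotientMap_toOrbit.isOpenMap

theorem isClosed_fibreSquare [T2Space G0] (hA : A.IsTopological) :
    IsClosed {p : X × X | A.r p.1 = A.r p.2} :=
  isClosed_eq (hA.continuous_r.comp continuous_fst) (hA.continuous_r.comp continuous_snd)

theorem isClosed_composable [T2Space G0] (hA : A.IsTopological) :
    IsClosed {p : G × X | 𝓖.s p.1 = A.r p.2} :=
  isClosed_eq (𝓖.continuous_s.comp continuous_fst) (hA.continuous_r.comp continuous_snd)

theorem IsTopological.diag (hA : A.IsTopological) : A.diag.IsTopological where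
  continuous_r := hA.continuous_r.comp (continuous_fst.comp continuous_subtype_val)
  isOpenMap_r := by
    have h := hA.isOpenMap_r.comp (isOpenMap_fibreProduct_snd hA.isOpenMap_r hA.continuous_r)
    convert h using 1
    ext p
    exact p.2
  continuous_smul := by
    have hv : Continuous fun p : {p : G × A.FibreSquare // 𝓖.s p.1 = A.diag.r p.2} => p.1.2.1 :=
      continuous_subtype_val.comp (continuous_snd.comp continuous_subtype_val)
    have hγ : Continuous fun p : {p : G × A.FibreSquare // 𝓖.s p.1 = A.diag.r p.2} => p.1.1 :=
      continuous_fst.comp continuous_subtype_val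
    refine Continuous.subtype_mk (Continuous.prodMk ?_ ?_) _
    · exact hA.continuous_smul.comp (Continuous.subtype_mk (hγ.prodMk hv.fst) fun p => p.2)
    · exact hA.continuous_smul.comp
        (Continuous.subtype_mk (hγ.prodMk hv.snd) fun p => p.2.trans p.1.2.2)

/-- Continuity of the action in a form suited to composition. -/
theorem IsTopological.continuous_smul_comp (hA : A.IsTopological) {T : Type*} [TopologicalSpace T]
    {g : T → G} {x : T → X} (hg : Continuous g) (hx : Continuous x)
    (h : ∀ t, 𝓖.s (g t) = A.r (x t)) : Continuous fun t => A.smul (g t) (x t) (h t) :=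
  hA.continuous_smul.comp ((hg.prodMk hx).subtype_mk h)

/-- The arrows carrying some point of a compact set into a compact set form a relatively compact
set. -/
theorem IsProper.exists_isCompact_arrows (hp : A.IsProper) {K L : Set X} (hK : IsCompact K)
    (hL : IsCompact L) : ∃ Γ : Set G, IsCompact Γ ∧
      ∀ γ x (h : 𝓖.s γ = A.r x), x ∈ K → A.smul γ x h ∈ L → γ ∈ Γ := by
  refine ⟨_, (hp.isCompact_preimage (hL.prod hK)).image
    (continuous_fst.comp continuous_subtype_val), ?_⟩
  intro γ x h hx hγ
  exact ⟨⟨(γ, x), h⟩, ⟨hγ, hx⟩, rfl⟩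

/-- The translates of a compact set by a compact set of arrows form a compact set. -/
theorem IsTopological.exists_isCompact_smul [T2Space G0] (hA : A.IsTopological) {Γ : Set G}
    {L : Set X} (hΓ : IsCompact Γ) (hL : IsCompact L) : ∃ M : Set X, IsCompact M ∧
      ∀ γ x (h : 𝓖.s γ = A.r x), γ ∈ Γ → x ∈ L → A.smul γ x h ∈ M := by
  have h1 := (isClosed_composable hA).isClosedEmbedding_subtypeVal.isCompact_preimage (hΓ.prod hL)
  refine ⟨_, h1.image hA.continuous_smul, ?_⟩
  intro γ x h hγ hx
  exact ⟨⟨(γ, x), h⟩, ⟨hγ, hx⟩, rfl⟩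

/-- The first coordinates alone already confine the arrow to a compact set. -/
theorem IsProper.diag [T2Space X] [T2Space G0] [T2Space G] [LocallyCompactSpace X]
    (hp : A.IsProper) (hA : A.IsTopological) : A.diag.IsProper := by
  have : LocallyCompactSpace A.FibreSquare :=
    (isClosed_fibreSquare hA).isClosedEmbedding_subtypeVal.locallyCompactSpace
  refine isProperMap_iff_isCompact_preimage.mpr ⟨hA.diag.continuous_smul.prodMk
    (continuous_snd.comp continuous_subtype_val), fun {K} hK => ?_⟩
  have hc : Continuous fun p : {p : G × A.FibreSquare // 𝓖.s p.1 = A.diag.r p.2} =>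
      (A.diag.smul p.1.1 p.1.2 p.2, p.1.2) := hA.diag.continuous_smul.prodMk
    (continuous_snd.comp continuous_subtype_val)
  have hK2 : IsCompact (Prod.snd '' K) := hK.image continuous_snd
  have hpr : Continuous fun p : A.FibreSquare => p.1.1 :=
    continuous_fst.comp continuous_subtype_val
  obtain ⟨Γ, hΓ, hΓ'⟩ := hp.exists_isCompact_arrows (hK2.image hpr)
    ((hK.image continuous_fst).image hpr)
  have h1 := (isClosed_composable hA.diag).isClosedEmbedding_subtypeVal.isCompact_preimage
    (hΓ.prod hK2)
  refine h1.of_isClosed_subset (hK.isClosed.preimage hc) ?_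
  rintro ⟨⟨γ, p⟩, h⟩ hk
  have h2 : p ∈ Prod.snd '' K := ⟨_, hk, rfl⟩
  exact ⟨hΓ' γ p.1.1 h ⟨p, h2, rfl⟩ ⟨A.diag.smul γ p h, ⟨_, hk, rfl⟩, rfl⟩, h2⟩

/-! ### The pair space -/

theorem continuous_pair_comp {T : Type*} [TopologicalSpace T] {x y : T → X} (hx : Continuous x)
    (hy : Continuous y) (h : ∀ t, A.r (x t) = A.r (y t)) :
    Continuous fun t => A.pair (x t) (y t) (h t) :=
  A.diag.continuous_toOrbit.comp ((hx.prodMk hy).subtype_mk h)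

/-- If `x` stays in a compact set and `[x, y]` in a compact set, then `y` stays in a compact set. -/
theorem exists_isCompact_of_pair_mem [T2Space G0] [LocallyCompactSpace X] (hA : A.IsTopological)
    (hp : A.IsProper) {N : Set X} (hN : IsCompact N) {K : Set A.PairSpace} (hK : IsCompact K) :
    ∃ M : Set X, IsCompact M ∧ ∀ x y h, x ∈ N → A.pair x y h ∈ K → y ∈ M := by
  have : LocallyCompactSpace A.FibreSquare :=
    (isClosed_fibreSquare hA).isClosedEmbedding_subtypeVal.locallyCompactSpace
  obtain ⟨L, hL, hKL⟩ := hA.diag.isOpenQuotientMap_toOrbit.exists_isCompact_subset_image hK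
  obtain ⟨Γ, hΓ, hΓ'⟩ := hp.exists_isCompact_arrows
    (hL.image (continuous_fst.comp continuous_subtype_val)) hN
  obtain ⟨M, hM, hM'⟩ := hA.exists_isCompact_smul hΓ
    (hL.image (continuous_snd.comp continuous_subtype_val))
  -- Lift `K` to a compact `L`. The arrow carrying a point `(a, b)` of `L` to `(x, y)` moves `a`
  -- into `N`, so it lies in a compact set, and `y` is its translate of `b`.
  refine ⟨M, hM, fun x y h hx hxy => ?_⟩
  obtain ⟨⟨⟨a, b⟩, hab⟩, hL', he⟩ := hKL hxy
  obtain ⟨γ, ha, hb, rfl, rfl⟩ := (pair_eq_pair_iff h hab).mp he.symm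
  exact hM' γ b hb (hΓ' γ a ha ⟨_, hL', rfl⟩ hx) ⟨_, hL', rfl⟩

theorem pairSpace_t2Space [T2Space G] [T2Space X] [T2Space G0] [LocallyCompactSpace X]
    (hA : A.IsProper) (hAt : A.IsTopological) : T2Space A.PairSpace :=
  hAt.diag.t2Space_orbitSpace (hA.diag hAt)

theorem pairSpace_locallyCompactSpace [T2Space G0] [LocallyCompactSpace X]
    (hAt : A.IsTopological) : LocallyCompactSpace A.PairSpace := by
  have : LocallyCompactSpace A.FibreSquare :=
    (isClosed_fibreSquare hAt).isClosedEmbedding_subtypeVal.locallyCompactSpace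
  exact hAt.diag.locallyCompactSpace_orbitSpace

theorem pairSpace_secondCountableTopology [SecondCountableTopology X]
    (hAt : A.IsTopological) : SecondCountableTopology A.PairSpace := by
  have : SecondCountableTopology A.FibreSquare :=
    TopologicalSpace.Subtype.secondCountableTopology {p : X × X | A.r p.1 = A.r p.2}
  exact hAt.diag.secondCountableTopology_orbitSpace

end GroupoidAction

/-! ### Images of measures under closed maps -/

/-- Change of variables along a closed map, for a function whose pull-back is continuous. -/
theorem IsClosedMap.integral_map_of_continuous_comp {K H : Type*} [TopologicalSpace K]
    [MeasurableSpace K] [BorelSpace K] [TopologicalSpace H] [MeasurableSpace H] [BorelSpace H]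
    {φ : K → H} (hcl : IsClosedMap φ) (hφ : Continuous φ) (μ : Measure K)
    {g : H → ℂ} (hg : Continuous (g ∘ φ)) : ∫ w, g w ∂(μ.map φ) = ∫ k, g (φ k) ∂μ := by
  refine integral_map hφ.measurable.aemeasurable ?_
  have hr : MeasurableSet (Set.range φ) := hcl.isClosed_range.measurableSet
  have hmem : ∀ᵐ w ∂(μ.map φ), w ∈ Set.range φ :=
    (ae_map_iff hφ.measurable.aemeasurable hr).mpr (.of_forall fun k => ⟨k, rfl⟩)
  -- A closed map is a quotient map onto its range, so `g` is continuous there. Since the image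
  -- measure lives on this closed set, measurability off the range is irrelevant.
  have hq : IsQuotientMap (Set.rangeFactorization φ) := by
    refine IsClosedMap.isQuotientMap ?_ (hφ.subtype_mk _) Set.rangeFactorization_surjective
    exact hcl.subtype_mk _
  have hc : ContinuousOn g (Set.range φ) := by
    rw [continuousOn_iff_continuous_domRestrict, hq.continuous_iff]
    exact hg
  have := hc.aestronglyMeasurable (μ := μ.map φ) hr
  rwa [Measure.restrict_eq_self_of_ae_mem hmem] at this

/-- The support of the image of a measure of full support on a compact space is the range. -/
theorem Continuous.support_map_eq_range {K H : Type*} [TopologicalSpace K] [CompactSpace K]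
    [MeasurableSpace K] [BorelSpace K] [TopologicalSpace H] [T2Space H] [MeasurableSpace H]
    [BorelSpace H] {φ : K → H} (hφ : Continuous φ) (μ : Measure K) [μ.IsOpenPosMeasure] :
    (μ.map φ).support = Set.range φ := by
  have hcl : IsClosed (Set.range φ) := hφ.isClosedMap.isClosed_range
  apply subset_antisymm
  · exact Measure.support_subset_of_isClosed hcl
      ((ae_map_iff hφ.measurable.aemeasurable hcl.measurableSet).mpr
        (.of_forall fun k => ⟨k, rfl⟩))
  · rintro _ ⟨k, rfl⟩
    rw [Measure.mem_support_iff_forall]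
    intro U hU
    refine lt_of_lt_of_le ?_ (measure_mono interior_subset)
    rw [Measure.map_apply hφ.measurable isOpen_interior.measurableSet]
    exact (isOpen_interior.preimage hφ).measure_pos μ ⟨k, mem_interior_iff_mem_nhds.mpr hU⟩

/-- A left invariant probability measure on a measurable group is invariant under inversion. -/
theorem MeasureTheory.Measure.map_inv_of_isMulLeftInvariant_of_isProbabilityMeasure {K : Type*}
    [Group K] [MeasurableSpace K] [MeasurableMul₂ K] [MeasurableInv K] (μ : Measure K)
    [μ.IsMulLeftInvariant] [IsProbabilityMeasure μ] : μ.map (fun k => k⁻¹) = μ := by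
  ext E hE
  have hm : Measurable (E.indicator (1 : K → ENNReal)) := measurable_one.indicator hE
  calc μ.map (fun k => k⁻¹) E = ∫⁻ x, E.indicator 1 x⁻¹ ∂μ := by
        rw [← lintegral_indicator_one hE, lintegral_map hm measurable_inv]
    _ = ∫⁻ y, ∫⁻ x, E.indicator 1 (x⁻¹ * y) ∂μ ∂μ := by
        have : ∀ y : K, ∫⁻ x, E.indicator 1 (x⁻¹ * y) ∂μ = ∫⁻ x, E.indicator 1 x⁻¹ ∂μ := by
          intro y
          rw [← lintegral_mul_left_eq_self (fun x => E.indicator (1 : K → ENNReal) x⁻¹) y⁻¹]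
          simp
        simp [this]
    _ = ∫⁻ x, ∫⁻ y, E.indicator 1 (x⁻¹ * y) ∂μ ∂μ := by
        apply lintegral_lintegral_swap
        apply Measurable.aemeasurable
        exact hm.comp (measurable_snd.inv.mul measurable_fst)
    _ = μ E := by
        have : ∀ x : K, ∫⁻ y, E.indicator 1 (x⁻¹ * y) ∂μ = μ E := by
          intro x
          rw [lintegral_mul_left_eq_self (fun y => E.indicator (1 : K → ENNReal) y) x⁻¹,
            lintegral_indicator_one hE]
        simp [this]

/-! ### Groupoid algebra -/

namespace TopGroupoid

variable {G G0 : Type*} [TopologicalSpace G] [TopologicalSpace G0] (𝓖 : TopGroupoid G G0)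

/-- In this and the following variants the composability proofs on the left-hand side are arbitrary,
so that `simp` can instantiate them by unification. -/
theorem mul_assoc_of_composable {γ₁ γ₂ γ₃ : G} (h₁₂ : 𝓖.s γ₁ = 𝓖.r γ₂)
    (h : 𝓖.s (𝓖.mul γ₁ γ₂ h₁₂) = 𝓖.r γ₃) :
    𝓖.mul (𝓖.mul γ₁ γ₂ h₁₂) γ₃ h = 𝓖.mul γ₁ (𝓖.mul γ₂ γ₃ ((𝓖.s_mul _ _ h₁₂).symm.trans h))
      (h₁₂.trans (𝓖.r_mul _ _ _).symm) :=
  𝓖.mul_assoc _ _ _ _ _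

theorem unit_mul_of_eq {γ : G} {u : G0} (h : 𝓖.s (𝓖.unit u) = 𝓖.r γ) :
    𝓖.mul (𝓖.unit u) γ h = γ := by
  obtain rfl : u = 𝓖.r γ := (𝓖.s_unit u).symm.trans h
  exact 𝓖.unit_mul γ

theorem mul_unit_of_eq {γ : G} {u : G0} (h : 𝓖.s γ = 𝓖.r (𝓖.unit u)) :
    𝓖.mul γ (𝓖.unit u) h = γ := by
  obtain rfl : 𝓖.s γ = u := h.trans (𝓖.r_unit u)
  exact 𝓖.mul_unit γ

theorem inv_mul_cancel_left {γ η : G} (h : 𝓖.s γ = 𝓖.r η)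
    (h' : 𝓖.s (𝓖.inv γ) = 𝓖.r (𝓖.mul γ η h)) : 𝓖.mul (𝓖.inv γ) (𝓖.mul γ η h) h' = η := by
  rw [← 𝓖.mul_assoc _ _ _ (𝓖.s_inv γ) h]
  simp only [𝓖.inv_mul, unit_mul_of_eq]

theorem mul_inv_cancel_left {γ η : G} (h : 𝓖.s (𝓖.inv γ) = 𝓖.r η)
    (h' : 𝓖.s γ = 𝓖.r (𝓖.mul (𝓖.inv γ) η h)) : 𝓖.mul γ (𝓖.mul (𝓖.inv γ) η h) h' = η := by
  rw [← 𝓖.mul_assoc _ _ _ (𝓖.r_inv γ).symm h]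
  simp only [𝓖.mul_inv, unit_mul_of_eq]

end TopGroupoid

/-! ### Algebra of actions and conjugation of isotropy groups -/

namespace GroupoidAction

section Algebra

variable {G G0 X : Type*} [TopologicalSpace G] [TopologicalSpace G0] {𝓖 : TopGroupoid G G0}
  {A : GroupoidAction 𝓖 X}

theorem smul_smul_of_eq {γ γ' : G} {x : X} (h' : 𝓖.s γ' = A.r x)
    (h : 𝓖.s γ = A.r (A.smul γ' x h')) :
    A.smul γ (A.smul γ' x h') h = A.smul (𝓖.mul γ γ' (h.trans (A.r_smul _ _ _))) x
      ((𝓖.s_mul _ _ _).trans h') :=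
  (A.mul_smul _ _ _ _ _).symm

theorem mul_smul_of_eq {γ γ' : G} {x : X} (h : 𝓖.s γ = 𝓖.r γ')
    (h' : 𝓖.s (𝓖.mul γ γ' h) = A.r x) :
    A.smul (𝓖.mul γ γ' h) x h' = A.smul γ (A.smul γ' x ((𝓖.s_mul _ _ _).symm.trans h'))
      (h.trans (A.r_smul _ _ _).symm) :=
  A.mul_smul _ _ _ _ _

theorem unit_smul_of_eq {u : G0} {x : X} (h : 𝓖.s (𝓖.unit u) = A.r x) :
    A.smul (𝓖.unit u) x h = x := by
  obtain rfl : u = A.r x := (𝓖.s_unit u).symm.trans h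
  exact A.unit_smul x

theorem inv_smul_smul {γ : G} {x : X} (h : 𝓖.s γ = A.r x)
    (h' : 𝓖.s (𝓖.inv γ) = A.r (A.smul γ x h)) : A.smul (𝓖.inv γ) (A.smul γ x h) h' = x := by
  rw [smul_smul_of_eq]
  simp only [𝓖.inv_mul, unit_smul_of_eq]

/-- Any composable pair of classes has the form `([x, y], [y, z])`. -/
theorem exists_pair_pair {x y y' z' : X} (h : A.r x = A.r y) (h' : A.r y' = A.r z')
    (hyy : A.toOrbit y = A.toOrbit y') :
    ∃ z hz, A.pair y' z' h' = A.pair y z hz := by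
  obtain ⟨γ, hγ, rfl⟩ := toOrbit_eq_iff.mp hyy
  exact ⟨A.smul γ z' (hγ.trans h'), (A.r_smul _ _ _).trans (A.r_smul _ _ _).symm,
    (pair_smul_smul _ _ _ _ _).symm⟩

namespace Isotropy

/-- An isotropy arrow from its defining property. -/
def mk {y : X} (ζ : G) (h : 𝓖.s ζ = A.r y) (h' : A.smul ζ y h = y) : A.Isotropy y := ⟨ζ, h, h'⟩

theorem mk_val {y : X} (ζ : G) (h : 𝓖.s ζ = A.r y) (h' : A.smul ζ y h = y) :
    (mk ζ h h').val = ζ := rfl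

/-- Conjugation by an arrow, from the isotropy group at `y` to the isotropy group at `γ y`. -/
def conj (γ : G) (y : X) (h : 𝓖.s γ = A.r y) : A.Isotropy y →* A.Isotropy (A.smul γ y h) where
  toFun ζ := mk (𝓖.mul γ (𝓖.mul ζ.val (𝓖.inv γ)
      ((ζ.s_val.trans h.symm).trans (𝓖.r_inv γ).symm))
      ((h.trans ζ.r_val.symm).trans (𝓖.r_mul _ _ _).symm))
    (by rw [𝓖.s_mul, 𝓖.s_mul, 𝓖.s_inv, A.r_smul])
    (by simp only [mul_smul_of_eq, inv_smul_smul, smul_val])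
  map_one' := ext (by
    simp only [mk_val, one_val, 𝓖.unit_mul_of_eq, 𝓖.mul_inv, A.r_smul])
  map_mul' ζ η := ext (by
    simp only [mk_val, mul_val, 𝓖.mul_assoc_of_composable, 𝓖.inv_mul_cancel_left])

theorem conj_val (γ : G) (y : X) (h : 𝓖.s γ = A.r y) (ζ : A.Isotropy y) :
    (conj γ y h ζ).val =
      𝓖.mul γ (𝓖.mul ζ.val (𝓖.inv γ) ((ζ.s_val.trans h.symm).trans (𝓖.r_inv γ).symm))
      ((h.trans ζ.r_val.symm).trans (𝓖.r_mul _ _ _).symm) := rfl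

theorem conj_smul_smul {γ : G} {y : X} {h : 𝓖.s γ = A.r y} {ζ : A.Isotropy y} {x : X}
    (hx : 𝓖.s γ = A.r x) (hζ : 𝓖.s (conj γ y h ζ).val = A.r (A.smul γ x hx)) :
    A.smul (conj γ y h ζ).val (A.smul γ x hx) hζ =
      A.smul γ (A.smul ζ.val x ((ζ.s_val.trans h.symm).trans hx))
        ((h.trans ζ.r_val.symm).trans (A.r_smul _ _ _).symm) := by
  simp only [conj_val, smul_smul_of_eq, 𝓖.mul_assoc_of_composable, 𝓖.inv_mul, 𝓖.mul_unit_of_eq]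

theorem conj_surjective (γ : G) (y : X) (h : 𝓖.s γ = A.r y) :
    Function.Surjective (conj γ y h) := by
  intro η
  have h1 : 𝓖.s η.val = 𝓖.r γ := η.s_val.trans (A.r_smul _ _ _)
  have h2 : 𝓖.r η.val = 𝓖.r γ := η.r_val.trans (A.r_smul _ _ _)
  have h3 : 𝓖.s (𝓖.inv γ) = 𝓖.r (𝓖.mul η.val γ h1) := by rw [𝓖.s_inv, 𝓖.r_mul, h2]
  -- The preimage of `η` is `γ⁻¹ηγ`.
  refine ⟨mk (𝓖.mul (𝓖.inv γ) (𝓖.mul η.val γ h1) h3) (by rw [𝓖.s_mul, 𝓖.s_mul, h]) ?_, ext ?_⟩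
  · simp only [mul_smul_of_eq, smul_val, inv_smul_smul]
  · simp only [conj_val, mk_val, 𝓖.mul_assoc_of_composable, 𝓖.mul_inv_cancel_left, 𝓖.mul_inv,
      𝓖.mul_unit_of_eq]

theorem continuous_conj (γ : G) (y : X) (h : 𝓖.s γ = A.r y) : Continuous (conj γ y h) := by
  have h1 : Continuous fun ζ : A.Isotropy y => 𝓖.mul ζ.val (𝓖.inv γ)
      ((ζ.s_val.trans h.symm).trans (𝓖.r_inv γ).symm) :=
    𝓖.continuous_mul.comp ((continuous_val.prodMk continuous_const).subtype_mk fun ζ =>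
      (ζ.s_val.trans h.symm).trans (𝓖.r_inv γ).symm)
  exact (𝓖.continuous_mul.comp ((continuous_const.prodMk h1).subtype_mk fun ζ =>
    (h.trans ζ.r_val.symm).trans (𝓖.r_mul _ _ _).symm)).subtype_mk _

instance [T2Space G] {y : X} : T2Space (A.Isotropy y) :=
  inferInstanceAs (T2Space {ζ : G // ∃ h : 𝓖.s ζ = A.r y, A.smul ζ y h = y})

instance [SecondCountableTopology G] {y : X} : SecondCountableTopology (A.Isotropy y) :=
  TopologicalSpace.Subtype.secondCountableTopology {ζ : G | ∃ h : 𝓖.s ζ = A.r y, A.smul ζ y h = y}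

end Isotropy

/-! ### The product of two classes -/

/-- The map `ζ ↦ [ζ x, z]` on the isotropy group at `y`. -/
def prodMap (A : GroupoidAction 𝓖 X) {x y z : X} (hxy : A.r x = A.r y) (hyz : A.r y = A.r z)
    (ζ : A.Isotropy y) : A.PairSpace :=
  A.pair (A.smul ζ.val x (ζ.s_val.trans hxy.symm)) z ((A.r_smul _ _ _).trans (ζ.r_val.trans hyz))

/-- Translating both entries by `ζ⁻¹` moves the isotropy from the first entry to the second. This is
what makes the involution and associativity visible. -/
theorem prodMap_eq_pair {x y z : X} (hxy : A.r x = A.r y) (hyz : A.r y = A.r z)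
    (ζ : A.Isotropy y) :
    A.prodMap hxy hyz ζ = A.pair x (A.smul (ζ⁻¹).val z ((ζ⁻¹).s_val.trans hyz))
      ((hxy.trans (ζ⁻¹).r_val.symm).trans (A.r_smul _ _ _).symm) := by
  rw [prodMap, ← pair_smul_smul _ (ζ⁻¹).val
    ((ζ⁻¹).s_val.trans (ζ.r_val.symm.trans (A.r_smul _ _ _).symm)) ((ζ⁻¹).s_val.trans hyz)]
  · simp only [Isotropy.inv_val, inv_smul_smul]
  · rw [A.r_smul, A.r_smul]

theorem pair_smul_isotropy {x y : X} (hxy : A.r x = A.r y) (ζ : A.Isotropy y)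
    (h : 𝓖.s ζ.val = A.r x) (h' : A.r (A.smul ζ.val x h) = A.r y) :
    A.pair (A.smul ζ.val x h) y h' = A.pair x y hxy := by
  rw [← pair_smul_smul hxy ζ.val h ζ.s_val]
  · simp only [Isotropy.smul_val]
  · rw [A.r_smul, A.r_smul]

end Algebra

variable {G G0 X : Type*} [TopologicalSpace G] [TopologicalSpace G0] [TopologicalSpace X]
  {𝓖 : TopGroupoid G G0} {A : GroupoidAction 𝓖 X}

theorem IsTopological.continuous_prodMap (hAt : A.IsTopological) {x y z : X}
    (hxy : A.r x = A.r y) (hyz : A.r y = A.r z) : Continuous (A.prodMap hxy hyz) :=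
  continuous_pair_comp (hAt.continuous_smul_comp Isotropy.continuous_val continuous_const _)
    continuous_const _

variable [MeasurableSpace G] [BorelSpace G]

/-! ### Normalized Haar measure of the isotropy groups -/

instance (hA : A.IsProper) (y : X) : (A.isotropyHaar hA y).IsHaarMeasure := by
  have := Isotropy.compactSpace (y := y) hA
  exact Measure.isHaarMeasure_haarMeasure _

instance (hA : A.IsProper) (y : X) : IsProbabilityMeasure (A.isotropyHaar hA y) := by
  have := Isotropy.compactSpace (y := y) hA
  exact ⟨Measure.haarMeasure_self (K₀ := (⊤ : TopologicalSpace.PositiveCompacts (A.Isotropy y)))⟩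

/-- A continuous surjective homomorphism of compact groups sends Haar measure to Haar measure, and
the normalized one is unique. -/
theorem map_conj_isotropyHaar [T2Space G] (hA : A.IsProper) (γ : G) (y : X)
    (h : 𝓖.s γ = A.r y) : (A.isotropyHaar hA y).map (Isotropy.conj γ y h) =
      A.isotropyHaar hA (A.smul γ y h) := by
  have := Isotropy.compactSpace (y := A.smul γ y h) hA
  have hc := Isotropy.continuous_conj γ y h
  have : ((A.isotropyHaar hA y).map (Isotropy.conj γ y h)).IsHaarMeasure :=
    Measure.isHaarMeasure_map_of_isFiniteMeasure _ _ hc (Isotropy.conj_surjective γ y h)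
  have : IsProbabilityMeasure ((A.isotropyHaar hA y).map (Isotropy.conj γ y h)) :=
    Measure.isProbabilityMeasure_map hc.measurable.aemeasurable
  exact Measure.isHaarMeasure_eq_of_isProbabilityMeasure _ _

/-- The image of the normalized Haar measure of the isotropy group at `y` under `ζ ↦ [ζ x, z]`. -/
noncomputable def prodMeasure (A : GroupoidAction 𝓖 X) (hA : A.IsProper) {x y z : X}
    (hxy : A.r x = A.r y) (hyz : A.r y = A.r z) : Measure A.PairSpace :=
  (A.isotropyHaar hA y).map (A.prodMap hxy hyz)

theorem prodMeasure_smul [T2Space G] (hA : A.IsProper) (hAt : A.IsTopological) {x y z : X}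
    (hxy : A.r x = A.r y) (hyz : A.r y = A.r z) (γ : G) (hx : 𝓖.s γ = A.r x)
    (hy : 𝓖.s γ = A.r y) (hz : 𝓖.s γ = A.r z)
    (hxy' : A.r (A.smul γ x hx) = A.r (A.smul γ y hy))
    (hyz' : A.r (A.smul γ y hy) = A.r (A.smul γ z hz)) :
    A.prodMeasure hA hxy' hyz' = A.prodMeasure hA hxy hyz := by
  rw [prodMeasure, ← map_conj_isotropyHaar, Measure.map_map
    (hAt.continuous_prodMap _ _).measurable (Isotropy.continuous_conj γ y hy).measurable]
  congr 1
  ext ζ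
  simp only [Function.comp, prodMap, Isotropy.conj_smul_smul]
  exact pair_smul_smul _ _ _ _ _

/-- Substituting `ηζ` for `ζ`, by left invariance, turns `[ζx, ηz]` into `[ηζx, ηz] = [ζx, z]`. -/
theorem prodMeasure_isotropy_smul (hA : A.IsProper) (hAt : A.IsTopological) {x y z : X}
    (hxy : A.r x = A.r y) (hyz : A.r y = A.r z) (η : A.Isotropy y) (hη : 𝓖.s η.val = A.r z)
    (h : A.r y = A.r (A.smul η.val z hη)) :
    A.prodMeasure hA hxy h = A.prodMeasure hA hxy hyz := by
  rw [prodMeasure, ← map_mul_left_eq_self (A.isotropyHaar hA y) η, Measure.map_map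
    (hAt.continuous_prodMap _ _).measurable (continuous_const_mul η).measurable]
  congr 1
  ext ζ
  simp only [Function.comp, prodMap, Isotropy.mul_val]
  rw [← pair_smul_smul _ η.val ((η.s_val.trans ζ.r_val.symm).trans (A.r_smul _ _ _).symm) hη]
  · simp only [smul_smul_of_eq]
  · rw [A.r_smul, A.r_smul]

theorem prodMeasure_congr [T2Space G] (hA : A.IsProper) (hAt : A.IsTopological)
    {x y z x' y' z' : X} (hxy : A.r x = A.r y) (hyz : A.r y = A.r z) (hxy' : A.r x' = A.r y')
    (hyz' : A.r y' = A.r z') (h : A.pair x y hxy = A.pair x' y' hxy')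
    (h' : A.pair y z hyz = A.pair y' z' hyz') :
    A.prodMeasure hA hxy hyz = A.prodMeasure hA hxy' hyz' := by
  obtain ⟨γ, hx, hy, rfl, rfl⟩ := (pair_eq_pair_iff _ _).mp h
  obtain ⟨γ', hy', hz', h1, rfl⟩ := (pair_eq_pair_iff _ _).mp h'
  have hr : 𝓖.r γ = 𝓖.r γ' := by rw [← A.r_smul γ y' hy, h1, A.r_smul]
  -- The arrows `γ` and `γ'` relating the two pairs of representatives both carry `y'` to the same
  -- point, so `γ⁻¹γ'` fixes `y'`. The change of representatives splits into this isotropy element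
  -- acting on `z'` and the common arrow `γ`.
  obtain ⟨η, hη⟩ : ∃ η : A.Isotropy y', η.val = 𝓖.mul (𝓖.inv γ) γ' ((𝓖.s_inv γ).trans hr) :=
    ⟨Isotropy.mk _ ((𝓖.s_mul _ _ _).trans hy') (by simp only [mul_smul_of_eq, ← h1, inv_smul_smul]),
      rfl⟩
  have hηz : 𝓖.s η.val = A.r z' := η.s_val.trans hyz'
  have hγ : 𝓖.s γ = A.r (A.smul η.val z' hηz) := by
    rw [A.r_smul, η.r_val, hy]
  have hz : A.smul γ' z' hz' = A.smul γ (A.smul η.val z' hηz) hγ := by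
    simp only [hη, smul_smul_of_eq, 𝓖.mul_inv_cancel_left]
  simp only [hz]
  rw [prodMeasure_smul hA hAt hxy'
      (hyz'.trans (hηz.symm.trans (by rw [A.r_smul, η.r_val, η.s_val]))),
    prodMeasure_isotropy_smul]
  assumption

theorem isProbabilityMeasure_prodMeasure (hA : A.IsProper) (hAt : A.IsTopological) {x y z : X}
    (hxy : A.r x = A.r y) (hyz : A.r y = A.r z) :
    IsProbabilityMeasure (A.prodMeasure hA hxy hyz) :=
  Measure.isProbabilityMeasure_map (hAt.continuous_prodMap hxy hyz).measurable.aemeasurable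

theorem prodMeasure_self_left (hA : A.IsProper) {x y : X} (h : A.r x = A.r x)
    (hxy : A.r x = A.r y) : A.prodMeasure hA h hxy = Measure.dirac (A.pair x y hxy) := by
  have : A.prodMap h hxy = fun _ => A.pair x y hxy := by
    ext ζ
    simp only [prodMap, Isotropy.smul_val]
  rw [prodMeasure, this, Measure.map_const, measure_univ, one_smul]

theorem prodMeasure_self_right (hA : A.IsProper) {x y : X} (hxy : A.r x = A.r y)
    (h : A.r y = A.r y) : A.prodMeasure hA hxy h = Measure.dirac (A.pair x y hxy) := by
  have : A.prodMap hxy h = fun _ => A.pair x y hxy := by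
    ext ζ
    exact pair_smul_isotropy hxy ζ _ _
  rw [prodMeasure, this, Measure.map_const, measure_univ, one_smul]

/-- Averages over an isotropy group of continuous functions are continuous. -/
theorem continuous_integral_isotropyHaar {T : Type*} [TopologicalSpace T]
    [FirstCountableTopology T] [LocallyCompactSpace T] (hA : A.IsProper) {y : X}
    {F : T → A.Isotropy y → ℂ}
    (hF : Continuous F.uncurry) : Continuous fun t => ∫ ζ, F t ζ ∂(A.isotropyHaar hA y) := by
  have := Isotropy.compactSpace (y := y) hA
  simpa using continuous_parametric_integral_of_continuous (μ := A.isotropyHaar hA y) hF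
    isCompact_univ

end GroupoidAction

namespace GroupoidAction

variable {G G0 X : Type*} [TopologicalSpace G] [TopologicalSpace G0] [TopologicalSpace X]
  {𝓖 : TopGroupoid G G0} {A : GroupoidAction 𝓖 X} [MeasurableSpace G] [BorelSpace G]

/-! ### The hypergroupoid of classes of pairs -/

theorem exists_prod [T2Space G] (hA : A.IsProper) (hAt : A.IsTopological) (v w : A.PairSpace) :
    ∃ μ : ProbabilityMeasure A.PairSpace, ∀ x y z (hxy : A.r x = A.r y) (hyz : A.r y = A.r z),
      v = A.pair x y hxy → w = A.pair y z hyz → (μ : Measure A.PairSpace) =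
        A.prodMeasure hA hxy hyz := by
  by_cases h : ∃ x y z, ∃ (hxy : A.r x = A.r y) (hyz : A.r y = A.r z),
      v = A.pair x y hxy ∧ w = A.pair y z hyz
  · obtain ⟨x, y, z, hxy, hyz, rfl, rfl⟩ := h
    refine ⟨⟨A.prodMeasure hA hxy hyz, isProbabilityMeasure_prodMeasure hA hAt hxy hyz⟩, ?_⟩
    intro x' y' z' hxy' hyz' h h'
    exact prodMeasure_congr hA hAt hxy hyz hxy' hyz' h h'
  -- Off the composable pairs the value is arbitrary; any probability measure would do.
  · refine ⟨⟨Measure.dirac v, inferInstance⟩, ?_⟩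
    intro x' y' z' hxy' hyz' hv hw
    exact absurd ⟨x', y', z', hxy', hyz', hv, hw⟩ h

/-- The hypergroupoid structure on `(X * X) / G`. -/
noncomputable def pairHypergroupoid [T2Space G] (hA : A.IsProper) (hAt : A.IsTopological) :
    HypergroupoidData A.PairSpace A.OrbitSpace where
  r := Quotient.lift (s := A.diag.orbitSetoid) (fun p => A.toOrbit p.1.1) (by
    rintro _ p ⟨γ, h, rfl⟩
    exact toOrbit_smul γ _ _)
  s := Quotient.lift (s := A.diag.orbitSetoid) (fun p => A.toOrbit p.1.2) (by
    rintro _ p ⟨γ, h, rfl⟩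
    exact toOrbit_smul γ _ _)
  unit := Quotient.lift (s := A.orbitSetoid) (fun x => A.pair x x rfl) (by
    rintro _ x ⟨γ, h, rfl⟩
    exact pair_smul_smul _ _ _ _ _)
  star := Quotient.lift (s := A.diag.orbitSetoid) (fun p => A.pair p.1.2 p.1.1 p.2.symm) (by
    rintro _ p ⟨γ, h, rfl⟩
    exact pair_smul_smul _ _ _ _ _)
  m v w _ := (exists_prod hA hAt v w).choose

section

variable [T2Space G] (hA : A.IsProper) (hAt : A.IsTopological)

local notation "ℋ" => pairHypergroupoid hA hAt

theorem r_pair (x y : X) (h : A.r x = A.r y) : (ℋ).r (A.pair x y h) = A.toOrbit x := rfl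

theorem s_pair (x y : X) (h : A.r x = A.r y) : (ℋ).s (A.pair x y h) = A.toOrbit y := rfl

theorem unit_toOrbit (x : X) : (ℋ).unit (A.toOrbit x) = A.pair x x rfl := rfl

theorem star_pair (x y : X) (h : A.r x = A.r y) :
    (ℋ).star (A.pair x y h) = A.pair y x h.symm := rfl

theorem m_pair {x y z : X} (hxy : A.r x = A.r y) (hyz : A.r y = A.r z)
    (h : (ℋ).s (A.pair x y hxy) = (ℋ).r (A.pair y z hyz)) :
    ((ℋ).m (A.pair x y hxy) (A.pair y z hyz) h : Measure A.PairSpace) =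
      A.prodMeasure hA hxy hyz :=
  (exists_prod hA hAt _ _).choose_spec x y z hxy hyz rfl rfl

theorem prod_pair {x y z : X} (hxy : A.r x = A.r y) (hyz : A.r y = A.r z) :
    (ℋ).prod (A.pair x y hxy) (A.pair y z hyz) = A.prodMeasure hA hxy hyz := by
  exact (dif_pos rfl).trans (m_pair hA hAt hxy hyz rfl)

theorem exists_composable {v w : A.PairSpace} (h : (ℋ).s v = (ℋ).r w) :
    ∃ x y z, ∃ (hxy : A.r x = A.r y) (hyz : A.r y = A.r z),
      v = A.pair x y hxy ∧ w = A.pair y z hyz := by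
  obtain ⟨x, y, hxy, rfl⟩ := exists_pair v
  obtain ⟨y', z', hyz, rfl⟩ := exists_pair w
  obtain ⟨z, hz, h'⟩ := exists_pair_pair hxy hyz h
  exact ⟨x, y, z, hxy, hz, rfl, h'⟩

variable {hA hAt}

theorem continuous_pairHypergroupoid_r : Continuous (ℋ).r :=
  hAt.diag.isOpenQuotientMap_toOrbit.continuous_comp_iff.mp
    (A.continuous_toOrbit.comp (continuous_fst.comp continuous_subtype_val))

theorem continuous_pairHypergroupoid_s : Continuous (ℋ).s :=
  hAt.diag.isOpenQuotientMap_toOrbit.continuous_comp_iff.mp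
    (A.continuous_toOrbit.comp (continuous_snd.comp continuous_subtype_val))

theorem continuous_pairHypergroupoid_unit : Continuous (ℋ).unit :=
  hAt.isOpenQuotientMap_toOrbit.continuous_comp_iff.mp
    (continuous_pair_comp continuous_id continuous_id _)

theorem continuous_pairHypergroupoid_star : Continuous (ℋ).star :=
  hAt.diag.isOpenQuotientMap_toOrbit.continuous_comp_iff.mp
    (continuous_pair_comp (continuous_snd.comp continuous_subtype_val)
      (continuous_fst.comp continuous_subtype_val) _)

theorem star_star (w : A.PairSpace) : (ℋ).star ((ℋ).star w) = w := by
  obtain ⟨x, y, h, rfl⟩ := exists_pair w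
  rfl

theorem r_star (w : A.PairSpace) : (ℋ).r ((ℋ).star w) = (ℋ).s w := by
  obtain ⟨x, y, h, rfl⟩ := exists_pair w
  rfl

theorem isOpenMap_pairHypergroupoid_s : IsOpenMap (ℋ).s :=
  hAt.diag.isOpenQuotientMap_toOrbit.isOpenMap_iff.mpr
    (hAt.isOpenQuotientMap_toOrbit.isOpenMap.comp
      (isOpenMap_fibreProduct_snd hAt.isOpenMap_r hAt.continuous_r))

theorem isOpenMap_pairHypergroupoid_r : IsOpenMap (ℋ).r := by
  intro U hU
  convert isOpenMap_pairHypergroupoid_s (hA := hA) (hAt := hAt) _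
    (hU.preimage (continuous_pairHypergroupoid_star (hA := hA) (hAt := hAt))) using 1
  ext u
  constructor
  · rintro ⟨w, hw, rfl⟩
    refine ⟨(ℋ).star w, ?_, ?_⟩
    · rwa [Set.mem_preimage, star_star]
    · rw [← r_star, star_star]
  · rintro ⟨w, hw, rfl⟩
    exact ⟨_, hw, r_star w⟩

/-! ### Support, units and involution -/

theorem support_prodMeasure [T2Space X] [T2Space G0] [LocallyCompactSpace X]
    {x y z : X} (hA : A.IsProper) (hAt : A.IsTopological)
    (hxy : A.r x = A.r y) (hyz : A.r y = A.r z) :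
    (A.prodMeasure hA hxy hyz).support = Set.range (A.prodMap hxy hyz) := by
  have := pairSpace_t2Space hA hAt
  have := Isotropy.compactSpace (y := y) hA
  exact (hAt.continuous_prodMap hxy hyz).support_map_eq_range _

/-- The involution sends `[ζx, z]` to `[z, ζx]`, which is the product map for `z, y, x` at `ζ⁻¹`;
Haar measure of the isotropy group is invariant under inversion. -/
theorem map_star_prodMeasure [SecondCountableTopology G] {x y z : X} (hxy : A.r x = A.r y)
    (hyz : A.r y = A.r z) :
    (A.prodMeasure hA hxy hyz).map (ℋ).star = A.prodMeasure hA hyz.symm hxy.symm := by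
  rw [prodMeasure, prodMeasure, Measure.map_map
    continuous_pairHypergroupoid_star.measurable (hAt.continuous_prodMap _ _).measurable]
  conv_rhs => rw [← (A.isotropyHaar hA y).map_inv_of_isMulLeftInvariant_of_isProbabilityMeasure]
  rw [Measure.map_map (hAt.continuous_prodMap _ _).measurable continuous_inv.measurable]
  congr 1
  ext ζ
  simp only [Function.comp, prodMap_eq_pair hyz.symm, inv_inv]
  rfl

/-! ### Convolution and associativity -/

theorem conv_pair {f : A.PairSpace → ℂ} (hf : Continuous f) {x y z : X} (hxy : A.r x = A.r y)
    (hyz : A.r y = A.r z) : (ℋ).conv f (A.pair x y hxy) (A.pair y z hyz) =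
      ∫ ζ, f (A.prodMap hxy hyz ζ) ∂(A.isotropyHaar hA y) := by
  rw [HypergroupoidData.conv, prod_pair, prodMeasure,
    integral_map (hAt.continuous_prodMap _ _).measurable.aemeasurable
      hf.measurable.aestronglyMeasurable]

/-- Both sides are iterated integrals of `f [ηx, ζ⁻¹w]` over `η ∈ G(y)` and `ζ ∈ G(z)`, taken in the
two orders. -/
theorem conv_assoc [T2Space X] [T2Space G0] [LocallyCompactSpace X] [SecondCountableTopology G]
    {f : A.PairSpace → ℂ} (hf : Continuous f) {x y z w : X} (hxy : A.r x = A.r y)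
    (hyz : A.r y = A.r z) (hzw : A.r z = A.r w) :
    ∫ v, (ℋ).conv f (A.pair x y hxy) v ∂(A.prodMeasure hA hyz hzw) =
      ∫ v, (ℋ).conv f v (A.pair z w hzw) ∂(A.prodMeasure hA hxy hyz) := by
  have := pairSpace_t2Space hA hAt
  have := Isotropy.compactSpace (y := y) hA
  have := Isotropy.compactSpace (y := z) hA
  have hζ (ζ : A.Isotropy z) : 𝓖.s (ζ⁻¹).val = A.r w := (ζ⁻¹).s_val.trans hzw
  have hζr (ζ : A.Isotropy z) : A.r (A.smul (ζ⁻¹).val w (hζ ζ)) = A.r z :=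
    (A.r_smul _ _ _).trans (ζ⁻¹).r_val
  have hη (η : A.Isotropy y) : 𝓖.s η.val = A.r x := η.s_val.trans hxy.symm
  have hηr (η : A.Isotropy y) : A.r (A.smul η.val x (hη η)) = A.r y :=
    (A.r_smul _ _ _).trans η.r_val
  let F (ζ : A.Isotropy z) (η : A.Isotropy y) : ℂ :=
    f (A.pair (A.smul η.val x (hη η)) (A.smul (ζ⁻¹).val w (hζ ζ))
      ((hηr η).trans (hyz.trans (hζr ζ).symm)))
  have hF : Continuous F.uncurry := by
    refine hf.comp (continuous_pair_comp ?_ ?_ _)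
    · exact hAt.continuous_smul_comp (Isotropy.continuous_val.comp continuous_snd)
        continuous_const _
    · exact hAt.continuous_smul_comp (Isotropy.continuous_val.comp continuous_fst.inv)
        continuous_const _
  have hF' : Continuous (fun η ζ => F ζ η).uncurry := hF.comp continuous_swap
  have h1 (ζ : A.Isotropy z) : (ℋ).conv f (A.pair x y hxy) (A.prodMap hyz hzw ζ) =
      ∫ η, F ζ η ∂(A.isotropyHaar hA y) := by
    rw [prodMap_eq_pair, conv_pair hf]
    rfl
  have h2 (η : A.Isotropy y) : (ℋ).conv f (A.prodMap hxy hyz η) (A.pair z w hzw) =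
      ∫ ζ, F ζ η ∂(A.isotropyHaar hA z) := by
    rw [prodMap, conv_pair hf]
    simp only [prodMap_eq_pair]
    rfl
  -- Continuity of the convolution is checked only after pull-back to the isotropy group, which
  -- suffices for the change of variables along a closed map.
  have c1 : Continuous ((ℋ).conv f (A.pair x y hxy) ∘ A.prodMap hyz hzw) := by
    simp only [Function.comp_def, h1]
    exact continuous_integral_isotropyHaar hA hF
  have c2 : Continuous ((fun v => (ℋ).conv f v (A.pair z w hzw)) ∘ A.prodMap hxy hyz) := by
    simp only [Function.comp_def, h2]
    exact continuous_integral_isotropyHaar hA hF'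
  rw [prodMeasure, prodMeasure,
    (hAt.continuous_prodMap _ _).isClosedMap.integral_map_of_continuous_comp
      (hAt.continuous_prodMap _ _) _ c1,
    (hAt.continuous_prodMap _ _).isClosedMap.integral_map_of_continuous_comp
      (hAt.continuous_prodMap _ _) _ c2]
  simp only [h1, h2]
  exact integral_integral_swap_of_hasCompactSupport hF (HasCompactSupport.of_compactSpace _)

end

end GroupoidAction

/-! ### Uniform estimates, the support axioms and left translation -/

namespace GroupoidAction

section Fibres

variable {G G0 X : Type*} [TopologicalSpace G] [TopologicalSpace G0] [TopologicalSpace X]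
  {𝓖 : TopGroupoid G G0} {A : GroupoidAction 𝓖 X}

/-- A continuous function of the class `[x, y]` extends to a continuous function on `X × X`. -/
theorem exists_continuous_extension [T2Space G0] [T2Space X] [LocallyCompactSpace X]
    [SecondCountableTopology X] (hAt : A.IsTopological) {f : A.PairSpace → ℂ} (hf : Continuous f) :
    ∃ F : C(X × X, ℂ), ∀ x y h, F (x, y) = f (A.pair x y h) := by
  obtain ⟨F, hF⟩ := ContinuousMap.exists_restrict_eq (isClosed_fibreSquare hAt)
    ⟨fun p : A.FibreSquare => f (A.diag.toOrbit p), hf.comp A.diag.continuous_toOrbit⟩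
  exact ⟨F, fun x y h => DFunLike.congr_fun hF ⟨(x, y), h⟩⟩

/-- If `f` is continuous with compact support on `(X * X) / G`, then `f [x, y]` and `f [z, y]` are
uniformly close when `x` and `z` are close. -/
theorem eventually_norm_pair_sub_pair_le [T2Space G0] [T2Space X] [LocallyCompactSpace X]
    [SecondCountableTopology X] (hAt : A.IsTopological) (hA : A.IsProper) (f : C_c(A.PairSpace, ℂ))
    {ε : ℝ} (hε : 0 < ε) (x₀ : X) : ∀ᶠ q : X × X in 𝓝 (x₀, x₀),
      ∀ y (hx : A.r q.1 = A.r y) (hz : A.r q.2 = A.r y),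
        ‖f (A.pair q.1 y hx) - f (A.pair q.2 y hz)‖ ≤ ε := by
  obtain ⟨F, hF⟩ := exists_continuous_extension hAt (f := f) f.continuous
  obtain ⟨N, hN, hxN⟩ := exists_compact_mem_nhds x₀
  obtain ⟨M, hM, hM'⟩ := exists_isCompact_of_pair_mem hAt hA hN f.hasCompactSupport.isCompact
  have h1 : ∀ᶠ q : X × X in 𝓝 (x₀, x₀), ∀ y ∈ M, ‖F (q.1, y) - F (q.2, y)‖ < ε := by
    refine hM.eventually_forall_of_forall_eventually fun y _ => ?_
    have hc : Continuous fun p : (X × X) × X => ‖F (p.1.1, p.2) - F (p.1.2, p.2)‖ := by fun_prop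
    exact hc.continuousAt.eventually_lt continuousAt_const (by simpa using hε)
  filter_upwards [h1, prod_mem_nhds hxN hxN] with q hq hqN y hx hz
  -- The tube argument controls `y ∈ M`; for `y ∉ M` both values of `f` vanish, because the first
  -- entries lie in `N`.
  by_cases hy : y ∈ M
  · rw [← hF, ← hF]
    exact (hq y hy).le
  · have h2 (x : X) (hx : A.r x = A.r y) (hxN : x ∈ N) : f (A.pair x y hx) = 0 :=
      image_eq_zero_of_notMem_tsupport fun h => hy (hM' x y hx hxN h)
    rw [h2 _ _ hqN.1, h2 _ _ hqN.2, sub_zero, norm_zero]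
    exact hε.le

end Fibres

variable {G G0 X : Type*} [TopologicalSpace G] [TopologicalSpace G0] [TopologicalSpace X]
  {𝓖 : TopGroupoid G G0} {A : GroupoidAction 𝓖 X} [MeasurableSpace G] [BorelSpace G]

section

variable [T2Space G] {hA : A.IsProper} {hAt : A.IsTopological}

local notation "ℋ" => pairHypergroupoid hA hAt

theorem support_prod [T2Space X] [T2Space G0] [LocallyCompactSpace X] {x y z : X}
    (hxy : A.r x = A.r y) (hyz : A.r y = A.r z) :
    ((ℋ).prod (A.pair x y hxy) (A.pair y z hyz)).support = Set.range (A.prodMap hxy hyz) := by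
  rw [prod_pair, support_prodMeasure]
  exact hAt

/-- A class `[ζx, z]` is a unit exactly when `ζx = z`, and some `ζ ∈ G(y)` satisfies this exactly
when `[x, y] = [z, y]`. -/
theorem eq_star_iff [T2Space X] [T2Space G0] [LocallyCompactSpace X] {v w : A.PairSpace}
    (h : (ℋ).s v = (ℋ).r w) :
    v = (ℋ).star w ↔ (((ℋ).prod v w).support ∩ Set.range (ℋ).unit).Nonempty := by
  obtain ⟨x, y, z, hxy, hyz, rfl, rfl⟩ := exists_composable hA hAt h
  rw [support_prod, star_pair, pair_eq_pair_iff]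
  constructor
  · rintro ⟨γ, hz, hy, rfl, h1⟩
    let ζ : A.Isotropy y := Isotropy.mk γ hy h1.symm
    refine ⟨_, ⟨ζ⁻¹, rfl⟩, A.toOrbit z, ?_⟩
    rw [unit_toOrbit, prodMap]
    simp only [Isotropy.inv_val, ζ, Isotropy.mk_val, inv_smul_smul]
  · rintro ⟨_, ⟨ζ, rfl⟩, u, hu⟩
    obtain ⟨t, rfl⟩ := A.toOrbit_surjective u
    rw [unit_toOrbit, prodMap, eq_comm, pair_eq_pair_iff] at hu
    obtain ⟨γ, h1, h2, h3, h4⟩ := hu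
    have hz : z = A.smul ζ.val x (ζ.s_val.trans hxy.symm) :=
      h4.trans h3.symm
    refine ⟨(ζ⁻¹).val, (ζ⁻¹).s_val.trans hyz, (ζ⁻¹).s_val, ?_, (ζ⁻¹).smul_val.symm⟩
    simp only [hz, Isotropy.inv_val, inv_smul_smul]

/-- A support point has the form `[ζx, z]` with `ζ` fixing `y`. If it is close to the diagonal, then
`f [ζx, y] = f [x, y]` is close to `f [z, y]`, uniformly in `y`. -/
theorem exists_nhdsSet [T2Space G0] [T2Space X] [LocallyCompactSpace X]
    [SecondCountableTopology X] (f : C_c(A.PairSpace, ℂ)) {ε : ℝ} (hε : 0 < ε) :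
    ∃ U ∈ 𝓝ˢ (Set.range (ℋ).unit), ∀ v w, (ℋ).s v = (ℋ).r w →
      (((ℋ).prod v w).support ∩ U).Nonempty → ‖f v - f ((ℋ).star w)‖ ≤ ε := by
  -- Quantifying over all representatives of `v` costs nothing: an arrow moving `(x, z)` to a
  -- representative near `(x₀, x₀)` moves `y` along and leaves both values of `f` unchanged.
  refine ⟨{v | ∀ x z (h : A.r x = A.r z) y (hx : A.r x = A.r y) (hz : A.r z = A.r y),
    v = A.pair x z h → ‖f (A.pair x y hx) - f (A.pair z y hz)‖ ≤ ε}, ?_, ?_⟩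
  · rw [mem_nhdsSet_iff_forall]
    rintro _ ⟨u, rfl⟩
    obtain ⟨x₀, rfl⟩ := A.toOrbit_surjective u
    rw [unit_toOrbit, pair, ← hAt.diag.isOpenQuotientMap_toOrbit.map_nhds_eq]
    have h1 := (continuous_subtype_val.tendsto (⟨(x₀, x₀), rfl⟩ : A.FibreSquare)).eventually
      (eventually_norm_pair_sub_pair_le hAt hA f hε x₀)
    refine Filter.eventually_map.mpr (h1.mono ?_)
    rintro ⟨⟨a, b⟩, hab⟩ hq x z h y hx hz heq
    obtain ⟨γ, ha, hb, rfl, rfl⟩ := (pair_eq_pair_iff hab h).mp heq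
    have hy : 𝓖.s γ = A.r y := ha.trans hx
    have := hq (A.smul γ y hy) ((A.r_smul _ _ _).trans (A.r_smul _ _ _).symm)
      ((A.r_smul _ _ _).trans (A.r_smul _ _ _).symm)
    rwa [pair_smul_smul hx, pair_smul_smul hz] at this
  · rintro v w hvw ⟨t, ht, htU⟩
    obtain ⟨x, y, z, hxy, hyz, rfl, rfl⟩ := exists_composable hA hAt hvw
    rw [support_prod] at ht
    obtain ⟨ζ, rfl⟩ := ht
    have h1 := htU _ z _ y ((A.r_smul _ _ _).trans ζ.r_val) hyz.symm rfl
    rwa [pair_smul_isotropy hxy] at h1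

/-! ### The fibres of the range map -/

variable (hA hAt) in
/-- The map `y ↦ [x, y]` from the fibre of `X` through `x` to the fibre over `[x]`. -/
noncomputable def fibreMap (x : X) (y : {y // A.r y = A.r x}) :
    {w : A.PairSpace // (ℋ).r w = A.toOrbit x} :=
  ⟨A.pair x y.1 y.2.symm, rfl⟩

theorem fibreMap_surjective (x : X) : Function.Surjective (fibreMap hA hAt x) := by
  rintro ⟨w, hw⟩
  obtain ⟨x', y', h', rfl⟩ := exists_pair w
  obtain ⟨z, hz, h⟩ := exists_pair_pair (x := x) rfl h' hw.symm
  exact ⟨⟨z, hz.symm⟩, Subtype.ext h.symm⟩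

theorem continuous_fibreMap (x : X) : Continuous (fibreMap hA hAt x) :=
  (continuous_pair_comp continuous_const continuous_subtype_val _).subtype_mk _

/-- Being proper and surjective, this map is a quotient map, so continuity on a fibre of `H` can be
tested on a fibre of `X`; properness also makes image measures finite on compact sets. -/
theorem isProperMap_fibreMap [T2Space X] [T2Space G0] [LocallyCompactSpace X] (x : X) :
    IsProperMap (fibreMap hA hAt x) := by
  have := pairSpace_t2Space hA hAt
  have := pairSpace_locallyCompactSpace hAt
  have := hAt.t2Space_orbitSpace hA
  have hcl : IsClosed {w : A.PairSpace | (ℋ).r w = A.toOrbit x} :=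
    isClosed_singleton.preimage continuous_pairHypergroupoid_r
  have hclX : IsClosed {y | A.r y = A.r x} := isClosed_singleton.preimage hAt.continuous_r
  have : LocallyCompactSpace {w : A.PairSpace // (ℋ).r w = A.toOrbit x} :=
    hcl.isClosedEmbedding_subtypeVal.locallyCompactSpace
  have hc := continuous_fibreMap (hA := hA) (hAt := hAt) x
  refine isProperMap_iff_isCompact_preimage.mpr ⟨hc, fun {K} hK => ?_⟩
  obtain ⟨M, hM, hM'⟩ := exists_isCompact_of_pair_mem hAt hA (isCompact_singleton (x := x))
    (hK.image continuous_subtype_val)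
  refine (hclX.isClosedEmbedding_subtypeVal.isCompact_preimage hM).of_isClosed_subset
    (hK.isClosed.preimage hc) ?_
  rintro ⟨y, hy⟩ hyK
  exact hM' x y hy.symm rfl ⟨_, hyK, rfl⟩

theorem leftTranslate_fibreMap [T2Space X] [T2Space G0] [LocallyCompactSpace X] {a b : X}
    (hab : A.r a = A.r b) {f : {w // (ℋ).r w = A.toOrbit b} → ℂ} (hf : Continuous f)
    (z : {z // A.r z = A.r a}) :
    (ℋ).leftTranslate (A.pair a b hab) f (fibreMap hA hAt a z) =
      ∫ ζ, f ⟨A.prodMap hab.symm z.2.symm ζ, toOrbit_smul _ _ _⟩ ∂(A.isotropyHaar hA a) := by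
  have := hAt.t2Space_orbitSpace hA
  have hcl : IsClosed {w : A.PairSpace | (ℋ).r w = A.toOrbit b} :=
    isClosed_singleton.preimage continuous_pairHypergroupoid_r
  let φ (ζ : A.Isotropy a) : {w : A.PairSpace // (ℋ).r w = A.toOrbit b} :=
    ⟨A.prodMap hab.symm z.2.symm ζ, toOrbit_smul _ _ _⟩
  have hφ : Continuous φ := (hAt.continuous_prodMap _ _).subtype_mk _
  have h1 : (ℋ).prod ((ℋ).star (A.pair a b hab)) (fibreMap hA hAt a z).1 =
      ((A.isotropyHaar hA a).map φ).map Subtype.val := by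
    rw [Measure.map_map measurable_subtype_coe hφ.measurable]
    exact prod_pair hA hAt hab.symm z.2.symm
  -- The product measure is pushed forward from the closed fibre, so restricting it to that fibre
  -- recovers the measure pushed forward.
  have h2 := (MeasurableEmbedding.subtype_coe hcl.measurableSet).comap_map
    ((A.isotropyHaar hA a).map φ)
  refine (congrArg (fun μ : Measure A.PairSpace =>
    ∫ w : {w : A.PairSpace // (ℋ).r w = A.toOrbit b}, f w ∂(μ.comap Subtype.val)) h1).trans ?_
  refine (congrArg (fun μ => ∫ w, f w ∂μ) h2).trans ?_
  exact integral_map hφ.measurable.aemeasurable hf.measurable.aestronglyMeasurable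

theorem continuous_leftTranslate [T2Space X] [T2Space G0] [LocallyCompactSpace X]
    [SecondCountableTopology X] (v : A.PairSpace)
    {f : {w // (ℋ).r w = (ℋ).s v} → ℂ} (hf : Continuous f) :
    Continuous ((ℋ).leftTranslate v f) := by
  obtain ⟨a, b, hab, rfl⟩ := exists_pair v
  have hclX : IsClosed {y | A.r y = A.r a} := isClosed_singleton.preimage hAt.continuous_r
  have : LocallyCompactSpace {y // A.r y = A.r a} :=
    hclX.isClosedEmbedding_subtypeVal.locallyCompactSpace
  have hp := isProperMap_fibreMap (hA := hA) (hAt := hAt) a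
  have hq := hp.isClosedMap.isQuotientMap hp.continuous (fibreMap_surjective a)
  refine hq.continuous_iff.mpr ?_
  have : SecondCountableTopology {y // A.r y = A.r a} :=
    TopologicalSpace.Subtype.secondCountableTopology {y | A.r y = A.r a}
  have hc : Continuous fun z : {y // A.r y = A.r a} =>
      ∫ ζ, f ⟨A.prodMap hab.symm z.2.symm ζ, toOrbit_smul _ _ _⟩ ∂(A.isotropyHaar hA a) := by
    refine continuous_integral_isotropyHaar hA (hf.comp (Continuous.subtype_mk ?_ _))
    exact continuous_pair_comp (hAt.continuous_smul_comp
      (Isotropy.continuous_val.comp continuous_snd) continuous_const _)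
      (continuous_subtype_val.comp continuous_fst) _
  exact hc.congr fun z => (leftTranslate_fibreMap hab hf z).symm

theorem hasCompactSupport_leftTranslate [T2Space X] [T2Space G0] [LocallyCompactSpace X]
    (v : A.PairSpace) {f : {w // (ℋ).r w = (ℋ).s v} → ℂ} (hf : Continuous f)
    (hfc : HasCompactSupport f) : HasCompactSupport ((ℋ).leftTranslate v f) := by
  obtain ⟨a, b, hab, rfl⟩ := exists_pair v
  have := pairSpace_t2Space hA hAt
  have := Isotropy.compactSpace (y := a) hA
  have hclX : IsClosed {y | A.r y = A.r a} := isClosed_singleton.preimage hAt.continuous_r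
  have hp := isProperMap_fibreMap (hA := hA) (hAt := hAt) a
  -- The integrand is `f [ζb, z]`. As `ζb` runs through this compact set, a nonzero value confines
  -- `z` to a compact set.
  have hN : IsCompact (Set.range fun ζ : A.Isotropy a =>
      A.smul ζ.val b (ζ.s_val.trans hab)) :=
    isCompact_range (hAt.continuous_smul_comp Isotropy.continuous_val continuous_const _)
  obtain ⟨M, hM, hM'⟩ := exists_isCompact_of_pair_mem hAt hA hN
    (hfc.isCompact.image continuous_subtype_val)
  refine HasCompactSupport.intro
    ((hclX.isClosedEmbedding_subtypeVal.isCompact_preimage hM).image hp.continuous) ?_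
  intro w hw
  obtain ⟨z, rfl⟩ := fibreMap_surjective (hA := hA) (hAt := hAt) a w
  refine (leftTranslate_fibreMap hab hf z).trans ?_
  refine integral_eq_zero_of_ae (.of_forall fun ζ => ?_)
  refine image_eq_zero_of_notMem_tsupport fun hζ => hw ⟨z, ?_, rfl⟩
  exact hM' _ _ _ ⟨ζ, rfl⟩ ⟨_, hζ, rfl⟩

theorem isLocallyCompactHypergroupoid [T2Space X] [T2Space G0] [LocallyCompactSpace X]
    [SecondCountableTopology X] [SecondCountableTopology G] :
    (ℋ).IsLocallyCompactHypergroupoid where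
  locallyCompactSpace := pairSpace_locallyCompactSpace hAt
  t2Space := pairSpace_t2Space hA hAt
  secondCountableTopology := pairSpace_secondCountableTopology hAt
  locallyCompactSpace_unit := hAt.locallyCompactSpace_orbitSpace
  t2Space_unit := hAt.t2Space_orbitSpace hA
  secondCountableTopology_unit := hAt.secondCountableTopology_orbitSpace
  continuous_r := continuous_pairHypergroupoid_r
  isOpenMap_r := isOpenMap_pairHypergroupoid_r
  surjective_r u := by
    obtain ⟨x, rfl⟩ := A.toOrbit_surjective u
    exact ⟨A.pair x x rfl, rfl⟩
  continuous_s := continuous_pairHypergroupoid_s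
  isOpenMap_s := isOpenMap_pairHypergroupoid_s
  surjective_s u := by
    obtain ⟨x, rfl⟩ := A.toOrbit_surjective u
    exact ⟨A.pair x x rfl, rfl⟩
  continuous_unit := continuous_pairHypergroupoid_unit
  injective_unit u v h := by
    obtain ⟨x, rfl⟩ := A.toOrbit_surjective u
    obtain ⟨y, rfl⟩ := A.toOrbit_surjective v
    exact congrArg (ℋ).r h
  r_unit u := by
    obtain ⟨x, rfl⟩ := A.toOrbit_surjective u
    rfl
  s_unit u := by
    obtain ⟨x, rfl⟩ := A.toOrbit_surjective u
    rfl
  continuous_star := continuous_pairHypergroupoid_star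
  star_star := star_star
  r_star := r_star
  isCompact_support v w h := by
    obtain ⟨x, y, z, hxy, hyz, rfl, rfl⟩ := exists_composable hA hAt h
    have := Isotropy.compactSpace (y := y) hA
    rw [support_prod]
    exact isCompact_range (hAt.continuous_prodMap hxy hyz)
  support_subset v w h := by
    obtain ⟨x, y, z, hxy, hyz, rfl, rfl⟩ := exists_composable hA hAt h
    rw [support_prod]
    rintro _ ⟨ζ, rfl⟩
    exact ⟨toOrbit_smul _ _ _, rfl⟩
  assoc v w t h h' f := by
    obtain ⟨x, y, z, hxy, hyz, rfl, rfl⟩ := exists_composable hA hAt h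
    obtain ⟨z', t', ht, rfl⟩ := exists_pair t
    obtain ⟨t, hzt, heq⟩ := exists_pair_pair hyz ht h'
    rw [heq, prod_pair, prod_pair]
    exact conv_assoc f.continuous hxy hyz hzt
  unit_prod v := by
    obtain ⟨x, y, hxy, rfl⟩ := exists_pair v
    rw [r_pair, unit_toOrbit, prod_pair, prodMeasure_self_left]
  prod_unit v := by
    obtain ⟨x, y, hxy, rfl⟩ := exists_pair v
    rw [s_pair, unit_toOrbit, prod_pair, prodMeasure_self_right]
  map_star v w h := by
    obtain ⟨x, y, z, hxy, hyz, rfl, rfl⟩ := exists_composable hA hAt h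
    rw [prod_pair, star_pair, star_pair, prod_pair, map_star_prodMeasure]
  eq_star_iff v w h := eq_star_iff h
  exists_nhds f ε hε := exists_nhdsSet f hε
  leftTranslate_mem v f := ⟨continuous_leftTranslate v f.continuous,
    hasCompactSupport_leftTranslate v f.continuous f.hasCompactSupport⟩

end

end GroupoidAction

/-! ### Parametric integrals and equivariant systems of measures -/

/-- Integrals along a continuous system of measures depend continuously on parameters, for
continuous integrands whose support is locally uniformly compact. -/
theorem IsContinuousSystem.continuous_parametric_integral {Y Z T : Type*} [TopologicalSpace Y]
    [TopologicalSpace Z] [TopologicalSpace T] [MeasurableSpace Y] [BorelSpace Y] [T2Space Y]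
    [LocallyCompactSpace Y] [SecondCountableTopology Y] [T1Space Z] {p : Y → Z}
    {α : ∀ z, Measure {y // p y = z}} (hα : IsContinuousSystem p α) (hp : Continuous p)
    {u : T → Z} (hu : Continuous u) {Φ : T → Y → ℂ} (hΦ : Continuous Φ.uncurry)
    (hsupp : ∀ t₀, ∃ M : Set Y, IsCompact M ∧ ∀ᶠ t in 𝓝 t₀, ∀ y, p y = u t → Φ t y ≠ 0 → y ∈ M) :
    Continuous fun t => ∫ y, Φ t y.1 ∂(α (u t)) := by
  rw [continuous_iff_continuousAt]
  intro t₀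
  obtain ⟨M, hM, hM'⟩ := hsupp t₀
  obtain ⟨χ, hχ1, -, hχc, hχ⟩ := exists_continuous_one_zero_of_isCompact hM isClosed_empty
    (Set.disjoint_empty M)
  have hemb (z : Z) : IsClosedEmbedding (Subtype.val : {y // p y = z} → Y) :=
    (isClosed_singleton.preimage hp).isClosedEmbedding_subtypeVal
  have hint (z : Z) {g : Y → ℂ} (hg : Continuous g) (hgc : HasCompactSupport g) :
      Integrable (fun y : {y // p y = z} => g y.1) (α z) := by
    have := hα.regular z
    exact (hg.comp continuous_subtype_val).integrable_of_hasCompactSupport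
      (hgc.comp_isClosedEmbedding (hemb z))
  let χ' (y : Y) : ℂ := χ y
  have hχ'c : Continuous χ' := Complex.continuous_ofReal.comp χ.continuous
  have hχ's : HasCompactSupport χ' := hχc.comp_left Complex.ofReal_zero
  have hmul {g : Y → ℂ} (hg : Continuous g) : Continuous (fun y => g y * χ' y) ∧
      HasCompactSupport fun y => g y * χ' y := ⟨hg.mul hχ'c, hχ's.mul_left⟩
  have hΦc (t : T) : Continuous (Φ t) := hΦ.comp (by fun_prop : Continuous fun y => (t, y))
  let c (t : T) : ℂ := ∫ y, χ' y.1 ∂(α (u t))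
  have hc : Continuous c := (hα.continuous_integral ⟨⟨χ', hχ'c⟩, hχ's⟩).comp hu
  let D (t : T) : ℂ := ∫ y, Φ t₀ y.1 * χ' y.1 ∂(α (u t))
  have hD : Continuous D :=
    (hα.continuous_integral ⟨⟨fun y => Φ t₀ y * χ' y, (hmul (hΦc t₀)).1⟩, (hmul (hΦc t₀)).2⟩).comp
      hu
  let I (t : T) : ℂ := ∫ y, Φ t y.1 ∂(α (u t))
  -- The cutoff equals `1` wherever the integrand is nonzero on the relevant fibre.
  have hI : ∀ᶠ t in 𝓝 t₀, I t = ∫ y, Φ t y.1 * χ' y.1 ∂(α (u t)) := by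
    filter_upwards [hM'] with t ht
    refine integral_congr_ae (.of_forall fun y => ?_)
    by_cases h : Φ t y.1 = 0
    · simp [h]
    · have : χ' y.1 = 1 := by simp [χ', hχ1 (ht y.1 y.2 h)]
      simp [this]
  -- `D` has the integrand frozen at `t₀` and only the measure varying. By uniform closeness on the
  -- support of `χ`, the error is at most `δ` times the cutoff mass `c`, which is bounded near `t₀`
  -- by continuity.
  have ho : (fun t => I t - D t) =o[𝓝 t₀] c := by
    rw [Asymptotics.isLittleO_iff]
    intro δ hδ
    have h1 : ∀ᶠ t in 𝓝 t₀, ∀ y ∈ tsupport χ, ‖Φ t y - Φ t₀ y‖ < δ := by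
      refine hχc.isCompact.eventually_forall_of_forall_eventually fun y _ => ?_
      have hcc : Continuous fun q : T × Y => ‖Φ q.1 q.2 - Φ t₀ q.2‖ :=
        (hΦ.sub ((hΦc t₀).comp continuous_snd)).norm
      exact hcc.continuousAt.eventually_lt continuousAt_const (by simpa using hδ)
    filter_upwards [hI, h1] with t ht h1
    have hcr : c t = ((∫ y, χ y.1 ∂(α (u t)) : ℝ) : ℂ) := integral_ofReal
    have hχi : Integrable (fun y : {y // p y = u t} => χ y.1) (α (u t)) := by
      simpa [χ'] using (hint (u t) hχ'c hχ's).re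
    have hnn : 0 ≤ ∫ y, χ y.1 ∂(α (u t)) := integral_nonneg fun y => (hχ y.1).1
    rw [ht, ← integral_sub (hint _ (hmul (hΦc t)).1 (hmul (hΦc t)).2)
      (hint _ (hmul (hΦc t₀)).1 (hmul (hΦc t₀)).2), hcr, Complex.norm_real, Real.norm_eq_abs,
      abs_of_nonneg hnn, ← integral_const_mul]
    refine norm_integral_le_of_norm_le (hχi.const_mul δ) (.of_forall fun y => ?_)
    rw [← sub_mul, norm_mul, Complex.norm_real, Real.norm_eq_abs, abs_of_nonneg (hχ y.1).1]
    by_cases h : χ y.1 = 0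
    · simp [h]
    · exact mul_le_mul_of_nonneg_right (h1 y.1 (subset_tsupport _ h)).le (hχ y.1).1
  have h0 : Filter.Tendsto (fun t => I t - D t) (𝓝 t₀) (𝓝 0) :=
    (Asymptotics.isLittleO_one_iff ℝ).mp (ho.trans_isBigO (hc.continuousAt.isBigO_one ℝ))
  have h2 := h0.add hD.continuousAt
  have h3 : D t₀ = I t₀ := hI.self_of_nhds.symm
  simp only [sub_add_cancel, zero_add, h3] at h2
  exact h2

namespace GroupoidAction

section Equivariance

variable {G G0 X : Type*} [TopologicalSpace G] [TopologicalSpace G0] {𝓖 : TopGroupoid G G0}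
  [MeasurableSpace X] {A : GroupoidAction 𝓖 X} {α : ∀ u, Measure {x // A.r x = u}}

/-- Free base points `u`, `v` avoid transporting measures between propositionally equal fibres. -/
theorem IsEquivariant.map_eq (hα : A.IsEquivariant α) {γ : G} {u v : G0} (hu : 𝓖.s γ = u)
    (hv : 𝓖.r γ = v) : (α u).map (fun x =>
      (⟨A.smul γ x.1 (hu.trans x.2.symm), (A.r_smul _ _ _).trans hv⟩ : {x // A.r x = v})) =
        α v := by
  subst hu hv
  exact hα γ

end Equivariance

variable {G G0 X : Type*} [TopologicalSpace G] [TopologicalSpace G0] [TopologicalSpace X]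
  {𝓖 : TopGroupoid G G0} {A : GroupoidAction 𝓖 X}

theorem IsTopological.continuous_smul_fibre (hAt : A.IsTopological) {γ : G} {u v : G0}
    (hu : 𝓖.s γ = u) (hv : 𝓖.r γ = v) : Continuous fun x : {x // A.r x = u} =>
      (⟨A.smul γ x.1 (hu.trans x.2.symm), (A.r_smul _ _ _).trans hv⟩ : {x // A.r x = v}) :=
  (hAt.continuous_smul_comp continuous_const continuous_subtype_val _).subtype_mk _

variable [MeasurableSpace X] [BorelSpace X] {α : ∀ u, Measure {x // A.r x = u}}

theorem IsEquivariant.integral_eq (hα : A.IsEquivariant α) (hAt : A.IsTopological) {γ : G}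
    {u v : G0} (hu : 𝓖.s γ = u) (hv : 𝓖.r γ = v) {f : {x // A.r x = v} → ℂ} (hf : Continuous f) :
    ∫ x, f x ∂(α v) = ∫ x, f ⟨A.smul γ x.1 (hu.trans x.2.symm), (A.r_smul _ _ _).trans hv⟩
      ∂(α u) := by
  rw [← hα.map_eq hu hv, integral_map (hAt.continuous_smul_fibre hu hv).measurable.aemeasurable
    hf.measurable.aestronglyMeasurable]

variable [MeasurableSpace G] [BorelSpace G]

/-- Averaging over the isotropy group disappears after integration against an equivariant
system. -/
theorem integral_average_mul [T2Space X] [T2Space G0] [LocallyCompactSpace X]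
    (hα : IsContinuousSystem A.r α) (hαe : A.IsEquivariant α)
    (hA : A.IsProper) (hAt : A.IsTopological) (f g : C_c(A.PairSpace, ℂ)) {a b : X}
    (hab : A.r a = A.r b) :
    ∫ z : {z // A.r z = A.r b}, (∫ ζ, f (A.prodMap hab z.2.symm ζ) ∂(A.isotropyHaar hA b)) *
        g (A.pair b z.1 z.2.symm) ∂(α (A.r b)) =
      ∫ z : {z // A.r z = A.r b}, f (A.pair a z.1 (hab.trans z.2.symm)) *
        g (A.pair b z.1 z.2.symm) ∂(α (A.r b)) := by
  have := Isotropy.compactSpace (y := b) hA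
  have := hα.regular (A.r b)
  have hclX : IsClosed {y | A.r y = A.r b} := isClosed_singleton.preimage hAt.continuous_r
  obtain ⟨M, hM, hM'⟩ := exists_isCompact_of_pair_mem hAt hA (isCompact_singleton (x := b))
    g.hasCompactSupport.isCompact
  let Φ (z : {y // A.r y = A.r b}) (ζ : A.Isotropy b) : ℂ :=
    f (A.prodMap hab z.2.symm ζ) * g (A.pair b z.1 z.2.symm)
  have hΦ : Continuous Φ.uncurry := by
    refine (f.continuous.comp (continuous_pair_comp ?_ ?_ _)).mul
      (g.continuous.comp (continuous_pair_comp continuous_const ?_ _))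
    · exact hAt.continuous_smul_comp (Isotropy.continuous_val.comp continuous_snd)
        continuous_const _
    · exact continuous_subtype_val.comp continuous_fst
    · exact continuous_subtype_val.comp continuous_fst
  have hΦc : HasCompactSupport Φ.uncurry := by
    refine HasCompactSupport.intro
      ((hclX.isClosedEmbedding_subtypeVal.isCompact_preimage hM).prod isCompact_univ) ?_
    rintro ⟨z, ζ⟩ hz
    have h0 : g (A.pair b z.1 z.2.symm) = 0 := image_eq_zero_of_notMem_tsupport fun h =>
      hz ⟨hM' _ _ _ rfl h, Set.mem_univ _⟩
    exact (congrArg _ h0).trans (mul_zero _)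
  -- For fixed `ζ ∈ G(b)`, equivariance permits replacing `z` by `ζz`. Then `[ζa, ζz] = [a, z]`, and
  -- `[b, ζz] = [b, z]` because `ζ` fixes `b`: the integral no longer depends on `ζ`.
  have h2 (ζ : A.Isotropy b) : ∫ z, Φ z ζ ∂(α (A.r b)) =
      ∫ z : {y // A.r y = A.r b}, f (A.pair a z.1 (hab.trans z.2.symm)) *
        g (A.pair b z.1 z.2.symm) ∂(α (A.r b)) := by
    have hΦζ : Continuous fun z => Φ z ζ := hΦ.comp (Continuous.prodMk_left ζ)
    rw [hαe.integral_eq hAt ζ.s_val ζ.r_val hΦζ]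
    refine integral_congr_ae (.of_forall fun z => ?_)
    have hz : 𝓖.s ζ.val = A.r z.1 := ζ.s_val.trans z.2.symm
    have hr : A.r b = A.r (A.smul ζ.val z.1 hz) := ((A.r_smul _ _ _).trans ζ.r_val).symm
    have e1 : A.prodMap hab hr ζ = A.pair a z.1 (hab.trans z.2.symm) :=
      pair_smul_smul (hab.trans z.2.symm) ζ.val (ζ.s_val.trans hab.symm) hz _
    have e2 : A.pair b (A.smul ζ.val z.1 hz) hr = A.pair b z.1 z.2.symm := by
      rw [← pair_smul_smul z.2.symm ζ.val ζ.s_val hz]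
      · simp only [Isotropy.smul_val]
      · rw [A.r_smul, A.r_smul]
    exact congrArg₂ (· * ·) (congrArg f e1) (congrArg g e2)
  calc _ = ∫ z, (∫ ζ, Φ z ζ ∂(A.isotropyHaar hA b)) ∂(α (A.r b)) :=
        integral_congr_ae (.of_forall fun z => (integral_mul_const _ _).symm)
    _ = ∫ ζ, (∫ z, Φ z ζ ∂(α (A.r b))) ∂(A.isotropyHaar hA b) :=
        integral_integral_swap_of_hasCompactSupport hΦ hΦc
    _ = _ := by simp only [h2, integral_const, probReal_univ, one_smul]

/-! ### The Haar system on the pair space -/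

section

variable [T2Space G] {hA : A.IsProper} {hAt : A.IsTopological}

local notation "ℋ" => pairHypergroupoid hA hAt

variable (hA hAt) in
-- Passing from `x₀` to `γx₀` transports `α` by `γ`, and `[γx₀, γy] = [x₀, y]`, so the image measure
-- is unchanged.
theorem exists_fibreMeasure (hα : A.IsEquivariant α) (u : A.OrbitSpace) :
    ∃ μ : Measure {w : A.PairSpace // (ℋ).r w = u}, ∀ x (h : A.toOrbit x = u),
      μ = (α (A.r x)).map fun y => ⟨A.pair x y.1 y.2.symm, h⟩ := by
  obtain ⟨x₀, rfl⟩ := A.toOrbit_surjective u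
  refine ⟨(α (A.r x₀)).map (fibreMap hA hAt x₀), fun x h => ?_⟩
  obtain ⟨γ, hγ, rfl⟩ := toOrbit_eq_iff.mp h
  have hc : Continuous fun y : {y // A.r y = A.r (A.smul γ x₀ hγ)} =>
      (⟨A.pair (A.smul γ x₀ hγ) y.1 y.2.symm, h⟩ :
        {w : A.PairSpace // (ℋ).r w = A.toOrbit x₀}) :=
    (continuous_pair_comp continuous_const continuous_subtype_val _).subtype_mk _
  have hr : 𝓖.r γ = A.r (A.smul γ x₀ hγ) := (A.r_smul _ _ _).symm
  rw [← hα.map_eq hγ hr, Measure.map_map hc.measurable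
    (hAt.continuous_smul_fibre hγ hr).measurable]
  congr 1
  funext y
  exact Subtype.ext (pair_smul_smul y.2.symm γ hγ (hγ.trans y.2.symm) _).symm

variable (hA hAt) in
/-- The Haar system on `(X * X) / G` given by an equivariant system of measures on `X`. -/
noncomputable def fibreMeasure (hα : A.IsEquivariant α) (u : A.OrbitSpace) :
    Measure {w : A.PairSpace // (ℋ).r w = u} :=
  (exists_fibreMeasure hA hAt hα u).choose

theorem fibreMeasure_toOrbit (hα : A.IsEquivariant α) (x : X) :
    fibreMeasure hA hAt hα (A.toOrbit x) = (α (A.r x)).map (fibreMap hA hAt x) :=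
  (exists_fibreMeasure hA hAt hα (A.toOrbit x)).choose_spec x rfl

variable (hA hAt) in
theorem isSpatialStructure (hαe : A.IsEquivariant α) :
    A.IsSpatialStructure hA α (ℋ) (fibreMeasure hA hAt hαe) where
  r_pair := r_pair hA hAt
  s_pair := s_pair hA hAt
  unit_toOrbit := unit_toOrbit hA hAt
  star_pair := star_pair hA hAt
  m_pair _ _ _ hxy hyz := m_pair hA hAt hxy hyz _
  lam_toOrbit := fibreMeasure_toOrbit hαe

variable [T2Space X] [T2Space G0] [LocallyCompactSpace X] [SecondCountableTopology X]

theorem isContinuousSystem_fibreMeasure (hα : IsContinuousSystem A.r α)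
    (hαe : A.IsEquivariant α) :
    IsContinuousSystem (ℋ).r (fibreMeasure hA hAt hαe) where
  regular u := by
    obtain ⟨x, rfl⟩ := A.toOrbit_surjective u
    have := pairSpace_t2Space hA hAt
    have := pairSpace_locallyCompactSpace hAt
    have := pairSpace_secondCountableTopology hAt
    have := hAt.t2Space_orbitSpace hA
    have hcl : IsClosed {w : A.PairSpace | (ℋ).r w = A.toOrbit x} :=
      isClosed_singleton.preimage continuous_pairHypergroupoid_r
    have : LocallyCompactSpace {w : A.PairSpace // (ℋ).r w = A.toOrbit x} :=
      hcl.isClosedEmbedding_subtypeVal.locallyCompactSpace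
    have : SecondCountableTopology {w : A.PairSpace // (ℋ).r w = A.toOrbit x} :=
      TopologicalSpace.Subtype.secondCountableTopology {w : A.PairSpace | (ℋ).r w = A.toOrbit x}
    have := hα.regular (A.r x)
    have : IsFiniteMeasureOnCompacts (fibreMeasure hA hAt hαe (A.toOrbit x)) := by
      refine ⟨fun K hK => ?_⟩
      rw [fibreMeasure_toOrbit, Measure.map_apply (continuous_fibreMap x).measurable
        hK.measurableSet]
      exact ((isProperMap_fibreMap x).isCompact_preimage hK).measure_lt_top
    -- On a locally compact second countable Hausdorff space, finiteness on compact sets already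
    -- gives regularity.
    infer_instance
  continuous_integral f := by
    refine hAt.isOpenQuotientMap_toOrbit.continuous_comp_iff.mp ?_
    obtain ⟨F, hF⟩ := exists_continuous_extension hAt (f := f) f.continuous
    -- The extension `F` need not have compact support; only its values on the fibres enter, where
    -- it equals `f [x, y]`.
    have h1 := hα.continuous_parametric_integral hAt.continuous_r (T := X) hAt.continuous_r
      (Φ := fun x y => F (x, y)) F.continuous (fun x₀ => by
        obtain ⟨N, hN, hxN⟩ := exists_compact_mem_nhds x₀
        obtain ⟨M, hM, hM'⟩ := exists_isCompact_of_pair_mem hAt hA hN f.hasCompactSupport.isCompact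
        refine ⟨M, hM, ?_⟩
        filter_upwards [hxN] with x hx y hy h
        rw [hF x y hy.symm] at h
        exact hM' x y hy.symm hx (subset_tsupport _ h))
    refine h1.congr fun x => ?_
    rw [Function.comp, fibreMeasure_toOrbit]
    refine (integral_congr_ae (.of_forall fun y : {y // A.r y = A.r x} =>
      hF x y.1 y.2.symm)).trans ?_
    have hfc : Continuous fun w : {w : A.PairSpace // (ℋ).r w = A.toOrbit x} => f w.1 :=
      f.continuous.comp continuous_subtype_val
    exact (integral_map (continuous_fibreMap x).measurable.aemeasurable
      hfc.measurable.aestronglyMeasurable).symm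

/-- The right-hand side is free of isotropy averages and symmetric in `(a, f)` and `(b, g)`; all
remaining Haar system properties are read off from it. -/
theorem integral_conv_mul (hα : IsContinuousSystem A.r α)
    (hαe : A.IsEquivariant α) (f g : C_c(A.PairSpace, ℂ)) {a b : X} {u : G0} (ha : A.r a = u)
    (hb : A.r b = u) :
    ∫ y, (ℋ).conv f (A.pair a b (ha.trans hb.symm)) y.1 * g y.1
        ∂(fibreMeasure hA hAt hαe (A.toOrbit b)) =
      ∫ z, f (A.pair a z.1 (ha.trans z.2.symm)) * g (A.pair b z.1 (hb.trans z.2.symm))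
        ∂(α u) := by
  subst hb
  refine Eq.trans ?_ (integral_average_mul hα hαe hA hAt f g ha)
  have hclX : IsClosed {y | A.r y = A.r b} := isClosed_singleton.preimage hAt.continuous_r
  have : LocallyCompactSpace {y // A.r y = A.r b} :=
    hclX.isClosedEmbedding_subtypeVal.locallyCompactSpace
  have : SecondCountableTopology {y // A.r y = A.r b} :=
    TopologicalSpace.Subtype.secondCountableTopology {y | A.r y = A.r b}
  have hconv (z : {y // A.r y = A.r b}) :
      (ℋ).conv f (A.pair a b ha) (A.pair b z.1 z.2.symm) * g (A.pair b z.1 z.2.symm) =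
        (∫ ζ, f (A.prodMap ha z.2.symm ζ) ∂(A.isotropyHaar hA b)) * g (A.pair b z.1 z.2.symm) :=
    congrArg (· * _) (conv_pair f.continuous ha z.2.symm)
  have hcc : Continuous fun z : {y // A.r y = A.r b} =>
      (∫ ζ, f (A.prodMap ha z.2.symm ζ) ∂(A.isotropyHaar hA b)) * g (A.pair b z.1 z.2.symm) := by
    refine (continuous_integral_isotropyHaar hA
      (F := fun z : {y // A.r y = A.r b} => fun ζ => f (A.prodMap ha z.2.symm ζ))
      (f.continuous.comp (continuous_pair_comp ?_ ?_ _))).mul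
      (g.continuous.comp (continuous_pair_comp continuous_const continuous_subtype_val _))
    · exact hAt.continuous_smul_comp (Isotropy.continuous_val.comp continuous_snd)
        continuous_const _
    · exact continuous_subtype_val.comp continuous_fst
  rw [fibreMeasure_toOrbit]
  let Ψ (y : {w : A.PairSpace // (ℋ).r w = A.toOrbit b}) : ℂ :=
    (ℋ).conv f (A.pair a b ha) y.1 * g y.1
  have hΨ : Continuous (Ψ ∘ fibreMap hA hAt b) := hcc.congr fun z => (hconv z).symm
  exact ((isProperMap_fibreMap b).isClosedMap.integral_map_of_continuous_comp
      (continuous_fibreMap b) (α (A.r b)) hΨ).trans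
      (integral_congr_ae (.of_forall hconv))

theorem continuous_integral_conv_mul (hα : IsContinuousSystem A.r α)
    (hαe : A.IsEquivariant α) (f g : C_c(A.PairSpace, ℂ)) :
    Continuous fun v => ∫ y, (ℋ).conv f v y.1 * g y.1 ∂(fibreMeasure hA hAt hαe ((ℋ).s v)) := by
  refine hAt.diag.isOpenQuotientMap_toOrbit.continuous_comp_iff.mp ?_
  obtain ⟨F, hF⟩ := exists_continuous_extension hAt (f := f) f.continuous
  obtain ⟨F', hF'⟩ := exists_continuous_extension hAt (f := g) g.continuous
  have hfst : Continuous fun p : A.FibreSquare => p.1.1 :=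
    continuous_fst.comp continuous_subtype_val
  have h1 := hα.continuous_parametric_integral hAt.continuous_r (T := A.FibreSquare)
    (hAt.continuous_r.comp hfst)
    (Φ := fun p y => F (p.1.1, y) * F' (p.1.2, y)) (by fun_prop) (fun p₀ => by
      obtain ⟨N, hN, hxN⟩ := exists_compact_mem_nhds p₀.1.1
      obtain ⟨M, hM, hM'⟩ := exists_isCompact_of_pair_mem hAt hA hN f.hasCompactSupport.isCompact
      refine ⟨M, hM, ?_⟩
      filter_upwards [hfst.continuousAt.preimage_mem_nhds hxN] with p hx y hy h
      rw [hF p.1.1 y hy.symm] at h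
      exact hM' p.1.1 y hy.symm hx (subset_tsupport _ (left_ne_zero_of_mul h)))
  refine h1.congr fun p => ?_
  refine Eq.trans ?_ (integral_conv_mul hα hαe f g rfl p.2.symm).symm
  refine integral_congr_ae (.of_forall fun z => ?_)
  exact congrArg₂ (· * ·) (hF _ _ z.2.symm) (hF' _ _ (p.2.symm.trans z.2.symm))

/-- A nonzero value at `[a, b]` requires some `z` with `f [a, z]` and `g [b, z]` nonzero. After
translation `(a, z)` lies in a compact lift of the support of `f`; then `[z, b]` lies in the starred
support of `g`, which confines `b`. -/
theorem hasCompactSupport_integral_conv_mul (hα : IsContinuousSystem A.r α)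
    (hαe : A.IsEquivariant α) (f g : C_c(A.PairSpace, ℂ)) :
    HasCompactSupport fun v =>
      ∫ y, (ℋ).conv f v y.1 * g y.1 ∂(fibreMeasure hA hAt hαe ((ℋ).s v)) := by
  have := pairSpace_t2Space hA hAt
  have hcl := isClosed_fibreSquare hAt
  have : LocallyCompactSpace A.FibreSquare := hcl.isClosedEmbedding_subtypeVal.locallyCompactSpace
  obtain ⟨L, hL, hfL⟩ := hAt.diag.isOpenQuotientMap_toOrbit.exists_isCompact_subset_image
    f.hasCompactSupport.isCompact
  have hL₁ := hL.image (continuous_fst.comp continuous_subtype_val)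
  have hL₂ := hL.image (continuous_snd.comp continuous_subtype_val)
  obtain ⟨M, hM, hM'⟩ := exists_isCompact_of_pair_mem hAt hA hL₂
    (g.hasCompactSupport.isCompact.image
      (continuous_pairHypergroupoid_star (hA := hA) (hAt := hAt)))
  refine HasCompactSupport.intro ((hcl.isClosedEmbedding_subtypeVal.isCompact_preimage
    (hL₁.prod hM)).image A.diag.continuous_toOrbit) ?_
  intro v hv
  obtain ⟨a, b, hab, rfl⟩ := exists_pair v
  refine (integral_conv_mul hα hαe f g hab rfl).trans ?_
  refine integral_eq_zero_of_ae (.of_forall fun z => ?_)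
  by_contra h
  obtain ⟨⟨⟨x, y⟩, hxy⟩, hmem, heq⟩ := hfL (subset_tsupport _ (left_ne_zero_of_mul h))
  obtain ⟨γ, hγx, hγz, rfl, rfl⟩ := (pair_eq_pair_iff hxy (hab.trans z.2.symm)).mp heq
  have hγb : 𝓖.s γ = A.r b := hγx.trans hab
  refine hv ⟨⟨(A.smul γ a hγx, A.smul γ b hγb), (A.r_smul _ _ _).trans (A.r_smul _ _ _).symm⟩,
    ⟨⟨_, hmem, rfl⟩, hM' (A.smul γ z.1 hγz) _ ((A.r_smul _ _ _).trans (A.r_smul _ _ _).symm)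
      ⟨_, hmem, rfl⟩ ?_⟩, pair_smul_smul _ _ _ _ _⟩
  rw [pair_smul_smul z.2]
  exact ⟨_, subset_tsupport _ (right_ne_zero_of_mul h), rfl⟩

theorem isHaarSystem_fibreMeasure (hα : IsContinuousSystem A.r α) (hαe : A.IsEquivariant α) :
    (ℋ).IsHaarSystem (fibreMeasure hA hAt hαe) where
  isContinuousSystem := isContinuousSystem_fibreMeasure hα hαe
  adjoint f g v := by
    obtain ⟨a, b, hab, rfl⟩ := exists_pair v
    refine (integral_conv_mul hα hαe f g rfl hab.symm).trans ?_
    -- Commuting the factors turns the second integral into the same formula with `f`, `g` and `a`,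
    -- `b` exchanged.
    simp only [mul_comm (f _)]
    exact (integral_conv_mul hα hαe g f hab.symm rfl).symm
  continuous_convolution := continuous_integral_conv_mul hα hαe
  hasCompactSupport_convolution := hasCompactSupport_integral_conv_mul hα hαe

end

end GroupoidAction

theorem theorem4p5 {G G0 X : Type*}
    [TopologicalSpace G] [LocallyCompactSpace G] [T2Space G] [SecondCountableTopology G]
    [MeasurableSpace G] [BorelSpace G]
    [TopologicalSpace G0] [LocallyCompactSpace G0] [T2Space G0] [SecondCountableTopology G0]
    [TopologicalSpace X] [LocallyCompactSpace X] [T2Space X] [SecondCountableTopology X]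
    [MeasurableSpace X] [BorelSpace X]
    (𝓖 : TopGroupoid G G0)
    (haar : ∀ u, Measure {γ // 𝓖.r γ = u}) (hhaar : 𝓖.IsHaarSystem haar)
    (A : GroupoidAction 𝓖 X) (hAtop : A.IsTopological) (hA : A.IsProper)
    (α : ∀ u, Measure {x // A.r x = u})
    (hα : IsContinuousSystem A.r α) (hαeq : A.IsEquivariant α) :
    ∃ (𝓗 : HypergroupoidData A.PairSpace A.OrbitSpace)
      (lam : ∀ u, Measure {w // 𝓗.r w = u}),
      A.IsSpatialStructure hA α 𝓗 lam ∧
      𝓗.IsLocallyCompactHypergroupoid ∧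
      𝓗.IsHaarSystem lam :=
  ⟨GroupoidAction.pairHypergroupoid hA hAtop, GroupoidAction.fibreMeasure hA hAtop hαeq,
    GroupoidAction.isSpatialStructure hA hAtop hαeq, GroupoidAction.isLocallyCompactHypergroupoid,
    GroupoidAction.isHaarSystem_fibreMeasure hα hαeq⟩
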